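/- Let $d\ge 2$ and $\mathcal U_d=\{\pm e_1,\dots,\pm e_d\}$. Consider either bond percolation on $\mathbb Z^d$, $\Omega=\{0,1\}^{\mathbb B_d}$ with $\mathbb B_d$ the set of nearest neighbour edges, or site percolation, $\Omega=\{0,1\}^{\mathbb Z^d}$; $\Omega$ carries the product $\sigma$-algebra and the shifts $(\tau_x\omega)_b=\omega_{x+b}$. For $\omega\in\Omega$ consider the graph of open bonds (respectively, of open sites, nearest neighbours being joined if both are open); its connected components are the clusters, $\mathcal C_\infty=\mathcal C_\infty(\omega)$ is the set of vertices in an infinite cluster, $d_{\rm ch}(x,y)$ is the graph distance of $x,y$ in their cluster, $\Omega_0=\{0\in\mathcal C_\infty\}$, and, for $\omega\in\Omega_0$ and $e\in\mathcal U_d$, $k(\omega,e)=\inf\{k\ge1:\tau_{ke}\omega\in\Omega_0\}$ and $v_e=k(\omega,e)e$. Let $\mathbb P$ be a probability measure on $\Omega$ such that: 1. $\mathbb P$-a.s. there is exactly one infinite cluster; 2. for each $x\in\mathbb Z^d\setminus\{0\}$, $\mathbb P$ is invariant and ergodic under $\tau_x$ (hence $\mathbb P(\Omega_0)>0$; put $\mathbb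 P_0=\mathbb P(\,\cdot\,|\Omega_0)$); 3. there are $c_1,\dots,c_4>0$ with $\mathbb P[d_{\rm ch}(0,x)\ge c_1|x|_1;\ 0,x\in\mathcal C_\infty]\le c_2\exp(-c_3(\log|x|_1)^{1+c_4})$ for all $x\in\mathbb Z^d\setminus\{0\}$; 4. there are $c_5,c_6>0$ with $\mathbb P_0[d_{\rm ch}(0,k(\omega,e)e)>n]\le c_5e^{-c_6n}$ for all $e\in\mathcal U_d$ and $n\in\mathbb N$; 5. $\mathbb P(A\cap B)\ge\mathbb P(A)\,\mathbb P(B)$ for all increasing events $A,B$. Let $\mathcal G_\infty$ be the class of all $G:\Omega_0\times\mathcal U_d\to\mathbb R$, measurable in $\omega$ (up to $\mathbb P_0$-null sets), such that (a) $\operatorname{ess\,sup}_{\mathbb P_0}G(\cdot,e)<\infty$ for every $e\in\mathcal U_d$; (b) $\mathbb P_0$-a.s., $\sum_{j=0}^{n-1}G(\tau_{x_j}\omega,x_{j+1}-x_j)=0$ for every closed open path $(x_0,\dots,x_n)$, $x_n=x_0$, in $\mathcal C_\infty$; (c) $\mathbb E_0[V_G(\cdot,v_e)]=0$ for every $e\in\mathcal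 U_d$. Here the corrector is $V_G(\omega,x)=\sum_{j=0}^{m-1}G(\tau_{x_j}\omega,x_{j+1}-x_j)$ for $x\in\mathcal C_\infty(\omega)$, where $(x_0,\dots,x_m)$ is any open path with $x_0=0$, $x_m=x$; by (b) it does not depend on the path, $\mathbb P_0$-a.s. **Theorem.** For every $G\in\mathcal G_\infty$, $V_G$ grows sublinearly on the infinite cluster: $$\lim_{n\to\infty}\ \max_{x\in\mathcal C_\infty(\omega),\ |x|\le n}\frac{|V_G(\omega,x)|}{n}=0\qquad\mathbb P_0\text{-a.s.},$$ where $|x|=\max_i|x_i|$. -/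

import Mathlib

open MeasureTheory ProbabilityTheory Filter Topology

namespace Percolation

/-- The lattice `ℤ^d`.  Its norm `‖x‖` is the maximum norm `max_i |x_i|`. -/
abbrev Zd (d : ℕ) := Fin d → ℤ

/-- The coordinate vector `e_i`. -/
def unitVec {d : ℕ} (i : Fin d) : Zd d := Pi.single i 1

/-- The set `𝒰_d = {±e_1, …, ±e_d}` of nearest neighbour steps. -/
def steps (d : ℕ) : Set (Zd d) := {e | ∃ i : Fin d, e = unitVec i ∨ e = -unitVec i}

/-- The `ℓ¹`-norm `|x|_1`. -/
def norm1 {d : ℕ} (x : Zd d) : ℝ := ∑ i, |(x i : ℝ)|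

/-! ### Bond and site configurations -/

/-- Bond configurations `{0,1}^{𝔹_d}`.  The pair `(x, i)` stands for the nearest neighbour edge
`{x, x + e_i}`; each nearest neighbour edge has exactly one such name. `true` means open. -/
abbrev BondConfig (d : ℕ) := Zd d × Fin d → Bool

/-- Site configurations `{0,1}^{ℤ^d}`; `true` means open. -/
abbrev SiteConfig (d : ℕ) := Zd d → Bool

/-- The shift `(τ_z ω)_b = ω_{z + b}` on bond configurations. -/
def bondShift {d : ℕ} (z : Zd d) (ω : BondConfig d) : BondConfig d :=
  fun b => ω (z + b.1, b.2)

/-- The shift `(τ_z ω)_x = ω_{z + x}` on site configurations. -/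
def siteShift {d : ℕ} (z : Zd d) (ω : SiteConfig d) : SiteConfig d :=
  fun x => ω (z + x)

theorem unitVec_ne_zero {d : ℕ} (i : Fin d) : unitVec i ≠ 0 := by
  intro h
  have := congrFun h i
  simp [unitVec] at this

/-- The graph on `ℤ^d` whose edges are the open bonds. -/
def bondGraph {d : ℕ} (ω : BondConfig d) : SimpleGraph (Zd d) where
  Adj x y := ∃ i : Fin d,
    (y = x + unitVec i ∧ ω (x, i) = true) ∨ (x = y + unitVec i ∧ ω (y, i) = true)
  symm := ⟨fun _ _ ⟨i, h⟩ => ⟨i, h.symm⟩⟩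
  loopless := ⟨fun x ⟨i, h⟩ => by
    rcases h with h | h <;> exact unitVec_ne_zero i (by simpa using h.1)⟩

/-- The graph of open sites: nearest neighbours are joined if both are open.  Closed sites are kept
as isolated vertices, which does not affect the infinite clusters. -/
def siteGraph {d : ℕ} (ω : SiteConfig d) : SimpleGraph (Zd d) where
  Adj x y := (y - x ∈ steps d) ∧ ω x = true ∧ ω y = true
  symm := ⟨fun x y ⟨⟨i, h⟩, hx, hy⟩ => ⟨⟨i, by
    rw [← neg_sub y x]
    rcases h with h | h
    · exact Or.inr (by rw [h])
    · exact Or.inl (by rw [h, neg_neg])⟩, hy, hx⟩⟩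
  loopless := ⟨fun x ⟨⟨i, h⟩, _, _⟩ => by
    rcases h with h | h
    · exact unitVec_ne_zero i (by simpa using h.symm)
    · exact unitVec_ne_zero i (by simpa using h.symm)⟩

/-! ### Clusters, chemical distance, first arrival

The notions below are common to the two kinds of models.  They are written for a space `Ω` of
configurations with shifts `τ` and with the open graph `𝒢 ω` of each configuration, and are used
for `(bondShift, bondGraph)` and `(siteShift, siteGraph)`. -/

section Common

variable {d : ℕ} {Ω : Type}

/-- `𝒞_∞(ω)`: the vertices whose cluster (connected component) is infinite. -/
def infCluster (𝒢 : Ω → SimpleGraph (Zd d)) (ω : Ω) : Set (Zd d) :=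
  {x | ((𝒢 ω).connectedComponentMk x).supp.Infinite}

/-- `Ω_0 = {0 ∈ 𝒞_∞}`. -/
def originInf (𝒢 : Ω → SimpleGraph (Zd d)) : Set Ω := {ω | 0 ∈ infCluster 𝒢 ω}

/-- `ℙ_0 = ℙ( · | Ω_0)`. -/
noncomputable def condOrigin [MeasurableSpace Ω] (𝒢 : Ω → SimpleGraph (Zd d))
    (P : Measure Ω) : Measure Ω :=
  ProbabilityTheory.cond P (originInf 𝒢)

/-- The chemical distance `d_ch(x, y)`: the minimal length of an open path from `x` to `y`
(only used for `x`, `y` in the infinite cluster). -/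
noncomputable def chemDist (𝒢 : Ω → SimpleGraph (Zd d)) (ω : Ω) (x y : Zd d) : ℕ :=
  (𝒢 ω).dist x y

/-- `k(ω, e) = inf {k ≥ 1 : τ_{k e} ω ∈ Ω_0}`. -/
noncomputable def firstReturn (τ : Zd d → Ω → Ω) (𝒢 : Ω → SimpleGraph (Zd d))
    (ω : Ω) (e : Zd d) : ℕ :=
  sInf {k : ℕ | 1 ≤ k ∧ τ ((k : ℤ) • e) ω ∈ originInf 𝒢}

/-- `v_e = k(ω, e) e`. -/
noncomputable def arrival (τ : Zd d → Ω → Ω) (𝒢 : Ω → SimpleGraph (Zd d))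
    (ω : Ω) (e : Zd d) : Zd d :=
  (firstReturn τ 𝒢 ω e : ℤ) • e

/-- The standing assumptions on the law `ℙ` of the percolation configuration. -/
structure StandingAssumptions [MeasurableSpace Ω] [Preorder Ω]
    (τ : Zd d → Ω → Ω) (𝒢 : Ω → SimpleGraph (Zd d)) (P : Measure Ω) : Prop where
  /-- `ℙ` is a probability measure. -/
  prob : IsProbabilityMeasure P
  /-- Almost surely there is exactly one infinite cluster. -/
  unique_cluster : ∀ᵐ ω ∂P, ∃! C : (𝒢 ω).ConnectedComponent, C.supp.Infinite
  /-- `ℙ` is invariant and ergodic under each single shift `τ_x`, `x ≠ 0`. -/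
  ergodic : ∀ x : Zd d, x ≠ 0 → Ergodic (τ x) P
  /-- The chemical distance in the infinite cluster is comparable to the lattice distance. -/
  chem_bound : ∃ c₁ c₂ c₃ c₄ : ℝ, 0 < c₁ ∧ 0 < c₂ ∧ 0 < c₃ ∧ 0 < c₄ ∧
    ∀ x : Zd d, x ≠ 0 →
      P.real {ω | c₁ * norm1 x ≤ (chemDist 𝒢 ω 0 x : ℝ) ∧
          0 ∈ infCluster 𝒢 ω ∧ x ∈ infCluster 𝒢 ω}
        ≤ c₂ * Real.exp (-c₃ * Real.log (norm1 x) ^ (1 + c₄))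
  /-- Exponential tail of the chemical distance from `0` to the first arrival `v_e`. -/
  arrival_tail : ∃ c₅ c₆ : ℝ, 0 < c₅ ∧ 0 < c₆ ∧ ∀ e ∈ steps d, ∀ n : ℕ,
    (condOrigin 𝒢 P).real {ω | n < chemDist 𝒢 ω 0 (arrival τ 𝒢 ω e)}
      ≤ c₅ * Real.exp (-c₆ * n)
  /-- The FKG inequality. -/
  fkg : ∀ A B : Set Ω, MeasurableSet A → MeasurableSet B → IsUpperSet A → IsUpperSet B →
    P A * P B ≤ P (A ∩ B)

/-! ### Gradients and correctors -/

/-- The sum `∑_j G(τ_{x_j} ω, x_{j+1} - x_j)` along an open path `(x_0, …, x_m)`.  The second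
argument of `G` is always a step in `𝒰_d`; the other values of `G` are never used. -/
def pathSum (τ : Zd d → Ω → Ω) (𝒢 : Ω → SimpleGraph (Zd d))
    (G : Ω → Zd d → ℝ) (ω : Ω) {x y : Zd d} (p : (𝒢 ω).Walk x y) : ℝ :=
  (p.darts.map fun a => G (τ a.fst ω) (a.snd - a.fst)).sum

open Classical in
/-- The corrector `V_G(ω, x)`: the sum of `G` along an open path from `0` to `x` (and `0` if there
is no such path).  For `G` in the class below the sum is almost surely independent of the path, for
all `x` in the infinite cluster, so that the choice made here does not matter. -/
noncomputable def corrector (τ : Zd d → Ω → Ω) (𝒢 : Ω → SimpleGraph (Zd d))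
    (G : Ω → Zd d → ℝ) (ω : Ω) (x : Zd d) : ℝ :=
  if h : (𝒢 ω).Reachable 0 x then pathSum τ 𝒢 G ω h.some else 0

/-- The class `𝒢_∞` of gradients. -/
structure GradientClass [MeasurableSpace Ω] (τ : Zd d → Ω → Ω)
    (𝒢 : Ω → SimpleGraph (Zd d)) (P : Measure Ω) (G : Ω → Zd d → ℝ) : Prop where
  meas : ∀ e ∈ steps d, AEMeasurable (fun ω => G ω e) (condOrigin 𝒢 P)
  /-- `ess sup G(·, e) < ∞` for every step `e`. -/
  bounded : ∃ A : ℝ, ∀ e ∈ steps d, ∀ᵐ ω ∂(condOrigin 𝒢 P), G ω e ≤ A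
  /-- Sums along closed loops in the infinite cluster vanish. -/
  closed_loop : ∀ᵐ ω ∂(condOrigin 𝒢 P), ∀ x ∈ infCluster 𝒢 ω, ∀ p : (𝒢 ω).Walk x x,
    pathSum τ 𝒢 G ω p = 0
  /-- `𝔼_0[V_G(·, v_e)] = 0`.  Integrability is automatic under the standing assumptions, from
  `bounded`, `closed_loop` and the exponential tail of the distance from `0` to `v_e`. -/
  induced_mean_zero : ∀ e ∈ steps d,
    ∫ ω, corrector τ 𝒢 G ω (arrival τ 𝒢 ω e) ∂(condOrigin 𝒢 P) = 0

/-- `max {|V_G(ω, x)| : x ∈ 𝒞_∞(ω), |x| ≤ n}`; the set is finite, and contains `0` if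
`ω ∈ Ω_0`, so that the supremum is a maximum. -/
noncomputable def maxCorrector (τ : Zd d → Ω → Ω) (𝒢 : Ω → SimpleGraph (Zd d))
    (G : Ω → Zd d → ℝ) (ω : Ω) (n : ℕ) : ℝ :=
  sSup ((fun x => |corrector τ 𝒢 G ω x|) '' {x | x ∈ infCluster 𝒢 ω ∧ ‖x‖ ≤ (n : ℝ)})

end Common

end Percolation

/-!
The argument is the same for bonds and sites; it uses only the shift-covariance of the open graph
(`IsLatticeModel`).

A closed loop of length two shows that a gradient which is bounded above is also bounded below on
the open edges of the infinite cluster. Almost every configuration is therefore *good*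
(`IsGood`, a shift-invariant property): the corrector is a cocycle on the infinite cluster and is
Lipschitz for the chemical distance.

**Axes.** For a step `e`, let `F` be `V_G(ω, v_e)` on `Ω_0` and `0` elsewhere. If `0` and `t e` lie
in the infinite cluster, then `V_G(ω, t e)` is the Birkhoff sum of length `t` of `F` under the full
shift `τ_e`. The tail of the chemical distance makes `F` integrable, and its mean is zero, so the
pointwise ergodic theorem (`eventually_abs_birkhoffSum_sub_le`) gives `V_G(ω, t e) = o(t)`.

**Nets.** The same theorem shows that the visits of the orbit under `τ_e` to a set `B ⊆ Ω_0` of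
positive measure leave only gaps that are short compared with time (`ae_exists_visit`). Take for
`B` configurations that already have points of small corrector near all sites of a coordinate
subspace; moving along one more axis first, and then inside the translated subspace, adds a
dimension (`IsGood.hasNet_insert`). After all the dimensions are treated, almost every `ω ∈ Ω_0`
has, within `δ ‖x‖ + M` of each site `x`, a point `y` of the infinite cluster with
`|V_G(ω, y)| ≤ δ ‖x‖ + M`.

**Everywhere.** By the Borel–Cantelli lemma, for `n` large, points of the infinite cluster in the
box of size `n` at distance at least `δ n` have chemical distance at most a constant times their
distance. A point `x` of this box is compared with a net point at distance between `δ n` and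
`8 δ n`, and the Lipschitz property bounds `V_G(ω, x)` by a constant times `δ n`.
-/

namespace Percolation

/-! ### The pointwise ergodic theorem for ergodic maps -/

section Birkhoff

variable {α : Type*}

/-- The running maximum `max_{0 ≤ k ≤ n} S_k f` of the Birkhoff sums of `f` under `T`, written
recursively in the form `M_{n+1} = max 0 (f + M_n ∘ T)`. -/
noncomputable def birkhoffMax (T : α → α) (f : α → ℝ) : ℕ → α → ℝ
  | 0, _ => 0
  | n + 1, x => max 0 (f x + birkhoffMax T f n (T x))

theorem birkhoffMax_nonneg (T : α → α) (f : α → ℝ) (n : ℕ) (x : α) :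
    0 ≤ birkhoffMax T f n x := by
  cases n with
  | zero => exact le_rfl
  | succ n => exact le_max_left _ _

theorem birkhoffMax_le_succ (T : α → α) (f : α → ℝ) (n : ℕ) (x : α) :
    birkhoffMax T f n x ≤ birkhoffMax T f (n + 1) x := by
  induction n generalizing x with
  | zero => exact birkhoffMax_nonneg T f 1 x
  | succ n ih => exact max_le_max le_rfl (by linarith [ih (T x)])

theorem birkhoffSum_le_birkhoffMax (T : α → α) (f : α → ℝ) (n : ℕ) (x : α) :
    birkhoffSum T f n x ≤ birkhoffMax T f n x := by
  induction n generalizing x with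
  | zero => simp [birkhoffMax]
  | succ n ih =>
    rw [birkhoffSum_succ']
    exact le_max_of_le_right (by linarith [ih (T x)])

variable [MeasurableSpace α] {μ : Measure α} {T : α → α} {f : α → ℝ}

theorem measurable_birkhoffMax (hT : Measurable T) (hf : Measurable f) (n : ℕ) :
    Measurable (birkhoffMax T f n) := by
  induction n with
  | zero => exact measurable_const
  | succ n ih => exact measurable_const.max (hf.add (ih.comp hT))

theorem integrable_birkhoffMax (hT : MeasurePreserving T μ μ) (hf : Integrable f μ) (n : ℕ) :
    Integrable (birkhoffMax T f n) μ := by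
  induction n with
  | zero => exact integrable_zero _ _ _
  | succ n ih => exact (integrable_zero _ _ _).sup (hf.add (hT.integrable_comp_of_integrable ih))

/-- The set where the Birkhoff sums are unbounded above is invariant.  If it had full measure, then
`M_{n+1} - M_n ∘ T = max (-M_n ∘ T) f` would converge to `f` there, while its integral is
nonnegative by invariance of `μ`; hence a negative integral of `f` rules this out. -/
theorem bddAbove_birkhoffMax_of_integral_neg [IsProbabilityMeasure μ] (hT : Ergodic T μ)
    (hfm : Measurable f) (hf : Integrable f μ) (hneg : ∫ x, f x ∂μ < 0) :
    ∀ᵐ x ∂μ, BddAbove (Set.range fun n => birkhoffMax T f n x) := by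
  set E : Set α := {x | BddAbove (Set.range fun n => birkhoffMax T f n x)} with hE
  have hEm : MeasurableSet E :=
    measurableSet_bddAbove_range fun n => measurable_birkhoffMax hT.measurable hfm n
  have hinv : T ⁻¹' E = E := by
    ext x
    simp only [hE, Set.mem_preimage, Set.mem_ofPred_eq]
    constructor
    · rintro ⟨b, hb⟩
      refine ⟨max 0 (f x + b), ?_⟩
      rintro _ ⟨n, rfl⟩
      have hn : birkhoffMax T f n (T x) ≤ b := hb ⟨n, rfl⟩
      exact (birkhoffMax_le_succ T f n x).trans (max_le_max le_rfl (by linarith))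
    · rintro ⟨b, hb⟩
      refine ⟨b - f x, ?_⟩
      rintro _ ⟨n, rfl⟩
      have hn : birkhoffMax T f (n + 1) x ≤ b := hb ⟨n + 1, rfl⟩
      have := (le_max_right 0 (f x + birkhoffMax T f n (T x))).trans hn
      simp only
      linarith
  rcases hT.toPreErgodic.ae_mem_or_ae_notMem hEm hinv with h | h
  · exact h
  exfalso
  have hlim : Tendsto (fun n => ∫ x, (birkhoffMax T f (n + 1) x - birkhoffMax T f n (T x)) ∂μ)
      atTop (𝓝 (∫ x, f x ∂μ)) := by
    refine tendsto_integral_of_dominated_convergence (fun x => |f x|) ?_ hf.abs ?_ ?_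
    · intro n
      exact ((measurable_birkhoffMax hT.measurable hfm (n + 1)).sub
        ((measurable_birkhoffMax hT.measurable hfm n).comp hT.measurable)).aestronglyMeasurable
    · intro n
      refine Eventually.of_forall fun x => ?_
      have h0 := birkhoffMax_nonneg T f n (T x)
      simp only [birkhoffMax, Real.norm_eq_abs]
      rcases le_total 0 (f x + birkhoffMax T f n (T x)) with hc | hc
      · rw [max_eq_right hc, add_sub_cancel_right]
      · rw [max_eq_left hc, zero_sub, abs_neg, abs_of_nonneg h0,
          abs_of_nonpos (by linarith)]
        linarith
    · filter_upwards [h] with x hx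
      have hTx : T x ∉ E := fun hc => hx (by rw [← hinv]; exact hc)
      have hex : ∃ N, -f x ≤ birkhoffMax T f N (T x) := by
        by_contra! hcon
        exact hTx ⟨-f x, by rintro _ ⟨n, rfl⟩; exact (hcon n).le⟩
      obtain ⟨N, hN⟩ := hex
      refine tendsto_const_nhds.congr' ?_
      filter_upwards [eventually_ge_atTop N] with n hn
      have := monotone_nat_of_le_succ (fun n => birkhoffMax_le_succ T f n (T x)) hn
      simp only [birkhoffMax]
      rw [max_eq_right (by linarith), add_sub_cancel_right]
  have hnn : ∀ n, 0 ≤ ∫ x, (birkhoffMax T f (n + 1) x - birkhoffMax T f n (T x)) ∂μ := by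
    intro n
    have hi := integrable_birkhoffMax hT.toMeasurePreserving hf
    have hcomp : ∫ x, birkhoffMax T f n (T x) ∂μ = ∫ x, birkhoffMax T f n x ∂μ := by
      have hm := (measurable_birkhoffMax hT.measurable hfm n).aestronglyMeasurable
        (μ := μ.map T)
      rw [← integral_map hT.measurable.aemeasurable hm, hT.map_eq]
    have hsub : ∫ x, (birkhoffMax T f (n + 1) x - birkhoffMax T f n (T x)) ∂μ =
        ∫ x, birkhoffMax T f (n + 1) x ∂μ - ∫ x, birkhoffMax T f n (T x) ∂μ :=
      integral_sub (hi (n + 1)) (hT.toMeasurePreserving.integrable_comp_of_integrable (hi n))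
    rw [hsub, hcomp, ← integral_sub (hi (n + 1)) (hi n)]
    exact integral_nonneg fun x => sub_nonneg.2 (birkhoffMax_le_succ T f n x)
  linarith [ge_of_tendsto' hlim hnn]

theorem eventually_birkhoffSum_le_of_measurable [IsProbabilityMeasure μ] (hT : Ergodic T μ)
    (hfm : Measurable f) (hf : Integrable f μ) {ε : ℝ} (hε : 0 < ε) :
    ∀ᵐ x ∂μ, ∀ᶠ n : ℕ in atTop, birkhoffSum T f n x ≤ (∫ y, f y ∂μ + ε) * n := by
  -- Half of `ε` makes the integral negative, the other half absorbs the bound on the sums.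
  set c := ∫ y, f y ∂μ + ε / 2 with hc
  have hg : Integrable (fun x => f x - c) μ := hf.sub (integrable_const c)
  have hneg : ∫ x, (f x - c) ∂μ < 0 := by
    rw [integral_sub hf (integrable_const c)]
    simp [hc, hε]
  filter_upwards [bddAbove_birkhoffMax_of_integral_neg hT (hfm.sub_const c) hg hneg] with x hx
  obtain ⟨b, hb⟩ := hx
  obtain ⟨N, hN⟩ := exists_nat_ge (b / (ε / 2))
  filter_upwards [eventually_ge_atTop N] with n hn
  have h1 : birkhoffSum T (fun x => f x - c) n x ≤ b :=
    (birkhoffSum_le_birkhoffMax _ _ _ _).trans (hb ⟨n, rfl⟩)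
  have h2 : birkhoffSum T (fun x => f x - c) n x = birkhoffSum T f n x - n * c := by
    simp [birkhoffSum, Finset.sum_sub_distrib]
  have h3 : b ≤ ε / 2 * n := by
    rw [div_le_iff₀ (by positivity)] at hN
    have : (N : ℝ) ≤ n := by exact_mod_cast hn
    nlinarith
  rw [h2] at h1
  have h4 : (∫ y, f y ∂μ + ε) * n = n * c + ε / 2 * n := by rw [hc]; ring
  linarith

theorem eventually_birkhoffSum_le [IsProbabilityMeasure μ] (hT : Ergodic T μ)
    (hf : Integrable f μ) {ε : ℝ} (hε : 0 < ε) :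
    ∀ᵐ x ∂μ, ∀ᶠ n : ℕ in atTop, birkhoffSum T f n x ≤ (∫ y, f y ∂μ + ε) * n := by
  have hae := hf.aemeasurable.ae_eq_mk
  have hsum : ∀ᵐ x ∂μ, ∀ n, birkhoffSum T f n x = birkhoffSum T (hf.aemeasurable.mk f) n x :=
    ae_all_iff.2 fun n =>
      hT.toMeasurePreserving.quasiMeasurePreserving.birkhoffSum_ae_eq_of_ae_eq hae n
  filter_upwards [hsum, eventually_birkhoffSum_le_of_measurable hT
    hf.aemeasurable.measurable_mk (hf.congr hae) hε] with x hx1 hx2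
  filter_upwards [hx2] with n hn
  rw [hx1 n, integral_congr_ae hae]
  exact hn

/-- The pointwise ergodic theorem, in the form of a linear bound on the deviations. -/
theorem eventually_abs_birkhoffSum_sub_le [IsProbabilityMeasure μ] (hT : Ergodic T μ)
    (hf : Integrable f μ) {ε : ℝ} (hε : 0 < ε) :
    ∀ᵐ x ∂μ, ∀ᶠ n : ℕ in atTop, |birkhoffSum T f n x - (∫ y, f y ∂μ) * n| ≤ ε * n := by
  filter_upwards [eventually_birkhoffSum_le hT hf hε, eventually_birkhoffSum_le hT hf.neg hε]
    with x h1 h2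
  filter_upwards [h1, h2] with n h1 h2
  have h3 : birkhoffSum T (-f) n x = -birkhoffSum T f n x := by
    simp [birkhoffSum]
  have h4 : ∫ y, (-f) y ∂μ = -∫ y, f y ∂μ := by simp [integral_neg]
  rw [h3, h4] at h2
  rw [abs_le]
  constructor <;> linarith

end Birkhoff

/-! ### Shift-covariant random graphs on the lattice -/

/-- The properties shared by the bond model and the site model: the `τ x` form an action of `ℤ^d`,
the open graph is covariant under it and consists of nearest neighbour edges, and the openness of
an edge is a measurable event. -/
structure IsLatticeModel {d : ℕ} {Ω : Type} [MeasurableSpace Ω] (τ : Zd d → Ω → Ω)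
    (𝒢 : Ω → SimpleGraph (Zd d)) : Prop where
  shift_zero : ∀ ω, τ 0 ω = ω
  shift_shift : ∀ x y ω, τ x (τ y ω) = τ (y + x) ω
  adj_shift : ∀ z ω x y, (𝒢 (τ z ω)).Adj x y ↔ (𝒢 ω).Adj (z + x) (z + y)
  sub_mem_steps : ∀ ω x y, (𝒢 ω).Adj x y → y - x ∈ steps d
  measurableSet_adj : ∀ x y, MeasurableSet {ω | (𝒢 ω).Adj x y}

theorem isLatticeModel_bond (d : ℕ) : IsLatticeModel (d := d) bondShift bondGraph where
  shift_zero ω := by funext b; simp [bondShift]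
  shift_shift x y ω := by funext b; simp [bondShift, add_assoc]
  adj_shift z ω x y := by simp [bondGraph, bondShift, add_assoc]
  sub_mem_steps ω x y h := by
    obtain ⟨i, ⟨h, -⟩ | ⟨h, -⟩⟩ := h
    · exact ⟨i, Or.inl (by simp [h])⟩
    · exact ⟨i, Or.inr (by simp [h])⟩
  measurableSet_adj x y := by
    have h (b : Zd d × Fin d) : MeasurableSet {ω : BondConfig d | ω b = true} :=
      measurable_pi_apply (X := fun _ => Bool) b (measurableSet_singleton true)
    have hU : {ω : BondConfig d | (bondGraph ω).Adj x y} =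
        ⋃ i : Fin d, ({ω | y = x + unitVec i} ∩ {ω | ω (x, i) = true}) ∪
          ({ω | x = y + unitVec i} ∩ {ω | ω (y, i) = true}) := by
      ext ω
      simp [bondGraph]
    rw [hU]
    exact MeasurableSet.iUnion fun i =>
      ((MeasurableSet.const _).inter (h _)).union ((MeasurableSet.const _).inter (h _))

theorem isLatticeModel_site (d : ℕ) : IsLatticeModel (d := d) siteShift siteGraph where
  shift_zero ω := by funext b; simp [siteShift]
  shift_shift x y ω := by funext b; simp [siteShift, add_assoc]
  adj_shift z ω x y := by simp [siteGraph, siteShift]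
  sub_mem_steps ω x y h := h.1
  measurableSet_adj x y := by
    have h (b : Zd d) : MeasurableSet {ω : SiteConfig d | ω b = true} :=
      measurable_pi_apply (X := fun _ => Bool) b (measurableSet_singleton true)
    exact (MeasurableSet.const _).inter ((h x).inter (h y))

theorem mem_infCluster_iff {d : ℕ} {Ω : Type} {𝒢 : Ω → SimpleGraph (Zd d)} {ω : Ω} {x : Zd d} :
    x ∈ infCluster 𝒢 ω ↔ {y | (𝒢 ω).Reachable y x}.Infinite := by
  have : ((𝒢 ω).connectedComponentMk x).supp = {y | (𝒢 ω).Reachable y x} := by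
    ext y
    simp [SimpleGraph.ConnectedComponent.mem_supp_iff, SimpleGraph.ConnectedComponent.eq]
  rw [infCluster, Set.mem_ofPred_eq, this]

theorem mem_infCluster_of_reachable {d : ℕ} {Ω : Type} {𝒢 : Ω → SimpleGraph (Zd d)} {ω : Ω}
    {x y : Zd d} (h : (𝒢 ω).Reachable x y) (hx : x ∈ infCluster 𝒢 ω) : y ∈ infCluster 𝒢 ω := by
  rw [mem_infCluster_iff] at hx ⊢
  exact hx.mono fun z hz => SimpleGraph.Reachable.trans hz h

theorem unitVec_mem_steps {d : ℕ} (i : Fin d) : unitVec i ∈ steps d := ⟨i, Or.inl rfl⟩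

theorem neg_unitVec_mem_steps {d : ℕ} (i : Fin d) : -unitVec i ∈ steps d := ⟨i, Or.inr rfl⟩

theorem ne_zero_of_mem_steps {d : ℕ} {e : Zd d} (he : e ∈ steps d) : e ≠ 0 := by
  obtain ⟨i, rfl | rfl⟩ := he
  · exact unitVec_ne_zero i
  · exact neg_ne_zero.2 (unitVec_ne_zero i)

namespace IsLatticeModel

variable {d : ℕ} {Ω : Type} [MeasurableSpace Ω] {τ : Zd d → Ω → Ω} {𝒢 : Ω → SimpleGraph (Zd d)}
  {G : Ω → Zd d → ℝ} {A : ℝ} {ω : Ω}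

theorem shift_neg_shift (hM : IsLatticeModel τ 𝒢) (z : Zd d) (ω : Ω) : τ (-z) (τ z ω) = ω := by
  rw [hM.shift_shift, add_neg_cancel, hM.shift_zero]

theorem iterate_shift (hM : IsLatticeModel τ 𝒢) (e : Zd d) (n : ℕ) (ω : Ω) :
    (τ e)^[n] ω = τ (n • e) ω := by
  induction n with
  | zero => simp [hM.shift_zero]
  | succ n ih => rw [Function.iterate_succ_apply', ih, hM.shift_shift, succ_nsmul]

/-- Translation by `-z`, as an isomorphism from the open graph of `ω` to that of `τ z ω`. -/
def shiftIso (hM : IsLatticeModel τ 𝒢) (z : Zd d) (ω : Ω) : 𝒢 ω ≃g 𝒢 (τ z ω) where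
  toEquiv := Equiv.subRight z
  map_rel_iff' {x y} := by
    rw [hM.adj_shift]
    simp

theorem shiftIso_apply (hM : IsLatticeModel τ 𝒢) (z : Zd d) (ω : Ω) (x : Zd d) :
    hM.shiftIso z ω x = x - z := rfl

theorem reachable_shift (hM : IsLatticeModel τ 𝒢) (z : Zd d) (ω : Ω) (x y : Zd d) :
    (𝒢 (τ z ω)).Reachable x y ↔ (𝒢 ω).Reachable (z + x) (z + y) := by
  rw [← (hM.shiftIso z ω).reachable_iff]
  simp [shiftIso_apply]

theorem mem_infCluster_shift (hM : IsLatticeModel τ 𝒢) (z : Zd d) (ω : Ω) (x : Zd d) :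
    x ∈ infCluster 𝒢 (τ z ω) ↔ z + x ∈ infCluster 𝒢 ω := by
  have : {y | (𝒢 (τ z ω)).Reachable y x} =
      (fun y => z + y) ⁻¹' {y | (𝒢 ω).Reachable y (z + x)} := by
    ext y
    exact hM.reachable_shift z ω y x
  rw [mem_infCluster_iff, mem_infCluster_iff, this]
  exact ⟨fun h hf => h (hf.preimage (add_right_injective z).injOn),
    fun h => h.preimage fun y _ => ⟨y - z, add_sub_cancel z y⟩⟩

theorem shift_mem_originInf (hM : IsLatticeModel τ 𝒢) (z : Zd d) (ω : Ω) :
    τ z ω ∈ originInf 𝒢 ↔ z ∈ infCluster 𝒢 ω := by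
  have := hM.mem_infCluster_shift z ω 0
  rwa [add_zero] at this

theorem chemDist_shift (hM : IsLatticeModel τ 𝒢) (z : Zd d) (ω : Ω) (x y : Zd d) :
    chemDist 𝒢 (τ z ω) x y = chemDist 𝒢 ω (z + x) (z + y) := by
  have key {ω' : Ω} {z' x' y' : Zd d} (h : (𝒢 ω').Reachable x' y') :
      (𝒢 (τ z' ω')).dist (x' - z') (y' - z') ≤ (𝒢 ω').dist x' y' := by
    obtain ⟨p, hp⟩ := h.exists_walk_length_eq_dist
    rw [← hp, ← SimpleGraph.Walk.length_map (hM.shiftIso z' ω').toHom p]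
    exact SimpleGraph.dist_le _
  unfold chemDist
  by_cases h : (𝒢 ω).Reachable (z + x) (z + y)
  · refine le_antisymm (by simpa using key (z' := z) h) ?_
    have := key (z' := -z) ((hM.reachable_shift z ω x y).2 h)
    rw [hM.shift_neg_shift] at this
    simpa [add_comm] using this
  · rw [SimpleGraph.dist_eq_zero_of_not_reachable h, SimpleGraph.dist_eq_zero_of_not_reachable]
    rwa [hM.reachable_shift]

theorem pathSum_map_shiftIso (hM : IsLatticeModel τ 𝒢) (z : Zd d) (ω : Ω) {x y : Zd d}
    (p : (𝒢 ω).Walk x y) :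
    pathSum τ 𝒢 G (τ z ω) (p.map (hM.shiftIso z ω).toHom) = pathSum τ 𝒢 G ω p := by
  induction p with
  | nil => rfl
  | @cons u v w h p ih =>
    simp only [pathSum, SimpleGraph.Walk.map_cons, SimpleGraph.Walk.darts_cons, List.map_cons,
      List.sum_cons] at ih ⊢
    rw [ih]
    congr 1
    change G (τ (u - z) (τ z ω)) ((v - z) - (u - z)) = _
    rw [hM.shift_shift, add_sub_cancel, sub_sub_sub_cancel_right]

end IsLatticeModel

section Walks

variable {d : ℕ} {Ω : Type} {τ : Zd d → Ω → Ω} {𝒢 : Ω → SimpleGraph (Zd d)}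
  {G : Ω → Zd d → ℝ} {A : ℝ} {ω : Ω}

theorem pathSum_append {x y z : Zd d} (p : (𝒢 ω).Walk x y) (q : (𝒢 ω).Walk y z) :
    pathSum τ 𝒢 G ω (p.append q) = pathSum τ 𝒢 G ω p + pathSum τ 𝒢 G ω q := by
  simp [pathSum, SimpleGraph.Walk.darts_append]

/-- The sums of `G` along closed walks in the infinite cluster vanish. -/
def LoopFree (τ : Zd d → Ω → Ω) (𝒢 : Ω → SimpleGraph (Zd d)) (G : Ω → Zd d → ℝ) (ω : Ω) : Prop :=
  ∀ x ∈ infCluster 𝒢 ω, ∀ p : (𝒢 ω).Walk x x, pathSum τ 𝒢 G ω p = 0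

theorem LoopFree.pathSum_eq (h : LoopFree τ 𝒢 G ω) {x y : Zd d} (hx : x ∈ infCluster 𝒢 ω)
    (p q : (𝒢 ω).Walk x y) : pathSum τ 𝒢 G ω p = pathSum τ 𝒢 G ω q := by
  have hp := h x hx (p.append q.reverse)
  have hq := h x hx (q.append q.reverse)
  rw [pathSum_append] at hp hq
  linarith

/-- The configurations for which the infinite cluster is connected, and `G` is a gradient on it,
with values at most `A` on the open edges. -/
structure IsGood (τ : Zd d → Ω → Ω) (𝒢 : Ω → SimpleGraph (Zd d)) (G : Ω → Zd d → ℝ) (A : ℝ)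
    (ω : Ω) : Prop where
  reachable : ∀ x ∈ infCluster 𝒢 ω, ∀ y ∈ infCluster 𝒢 ω, (𝒢 ω).Reachable x y
  loopFree : LoopFree τ 𝒢 G ω
  le_bound : ∀ x ∈ infCluster 𝒢 ω, ∀ y, (𝒢 ω).Adj x y → G (τ x ω) (y - x) ≤ A

/-- An edge and its reversal form a loop, so that the one-sided bound on `G` is two-sided. -/
theorem IsGood.abs_le (h : IsGood τ 𝒢 G A ω) {x y : Zd d} (hx : x ∈ infCluster 𝒢 ω)
    (hxy : (𝒢 ω).Adj x y) : |G (τ x ω) (y - x)| ≤ A := by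
  have hy := mem_infCluster_of_reachable hxy.reachable hx
  have hloop := h.loopFree x hx (.cons hxy (.cons hxy.symm .nil))
  have h1 := h.le_bound x hx y hxy
  have h2 := h.le_bound y hy x hxy.symm
  simp [pathSum] at hloop
  rw [_root_.abs_le]
  constructor <;> linarith

theorem IsGood.abs_pathSum_le (h : IsGood τ 𝒢 G A ω) {x y : Zd d} (hx : x ∈ infCluster 𝒢 ω)
    (p : (𝒢 ω).Walk x y) : |pathSum τ 𝒢 G ω p| ≤ A * p.length := by
  induction p with
  | nil => simp [pathSum]
  | @cons u v w huv p ih =>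
    have h1 := h.abs_le hx huv
    have h2 := ih (mem_infCluster_of_reachable huv.reachable hx)
    have h3 : pathSum τ 𝒢 G ω (.cons huv p) = G (τ u ω) (v - u) + pathSum τ 𝒢 G ω p := by
      simp [pathSum]
    rw [h3, SimpleGraph.Walk.length_cons]
    push_cast
    linarith [abs_add_le (G (τ u ω) (v - u)) (pathSum τ 𝒢 G ω p)]

theorem LoopFree.corrector_eq (h : LoopFree τ 𝒢 G ω) (h0 : 0 ∈ infCluster 𝒢 ω) {x : Zd d}
    (p : (𝒢 ω).Walk 0 x) : corrector τ 𝒢 G ω x = pathSum τ 𝒢 G ω p := by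
  rw [corrector, dif_pos p.reachable]
  exact h.pathSum_eq h0 _ _

theorem IsGood.corrector_zero (h : IsGood τ 𝒢 G A ω) (h0 : 0 ∈ infCluster 𝒢 ω) :
    corrector τ 𝒢 G ω 0 = 0 := by
  rw [h.loopFree.corrector_eq h0 .nil]
  simp [pathSum]

theorem IsGood.abs_corrector_le (h : IsGood τ 𝒢 G A ω) (h0 : 0 ∈ infCluster 𝒢 ω) (x : Zd d) :
    |corrector τ 𝒢 G ω x| ≤ A * chemDist 𝒢 ω 0 x := by
  by_cases hr : (𝒢 ω).Reachable 0 x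
  · obtain ⟨p, hp⟩ := hr.exists_walk_length_eq_dist
    rw [h.loopFree.corrector_eq h0 p, chemDist, ← hp]
    exact h.abs_pathSum_le h0 p
  · rw [corrector, dif_neg hr, chemDist, SimpleGraph.dist_eq_zero_of_not_reachable hr]
    simp

end Walks

section Shifts

variable {d : ℕ} {Ω : Type} [MeasurableSpace Ω] {τ : Zd d → Ω → Ω} {𝒢 : Ω → SimpleGraph (Zd d)}
  {G : Ω → Zd d → ℝ} {A : ℝ} {ω : Ω}

theorem LoopFree.of_shift (hM : IsLatticeModel τ 𝒢) {z : Zd d} (h : LoopFree τ 𝒢 G (τ z ω)) :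
    LoopFree τ 𝒢 G ω := by
  intro x hx p
  rw [← hM.pathSum_map_shiftIso z ω p]
  refine h _ ?_ _
  rw [hM.mem_infCluster_shift]
  change z + (x - z) ∈ _
  rwa [add_sub_cancel]

theorem LoopFree.shift (hM : IsLatticeModel τ 𝒢) (h : LoopFree τ 𝒢 G ω) (z : Zd d) :
    LoopFree τ 𝒢 G (τ z ω) := by
  refine LoopFree.of_shift hM (z := -z) ?_
  rwa [hM.shift_neg_shift]

theorem IsGood.shift (hM : IsLatticeModel τ 𝒢) (h : IsGood τ 𝒢 G A ω) (z : Zd d) :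
    IsGood τ 𝒢 G A (τ z ω) where
  reachable x hx y hy := by
    rw [hM.mem_infCluster_shift] at hx hy
    rw [hM.reachable_shift]
    exact h.reachable _ hx _ hy
  loopFree := h.loopFree.shift hM z
  le_bound x hx y hxy := by
    rw [hM.mem_infCluster_shift] at hx
    rw [hM.adj_shift] at hxy
    rw [hM.shift_shift]
    have := h.le_bound _ hx _ hxy
    rwa [add_sub_add_left_eq_sub] at this

/-- Seen from a point `x` of the infinite cluster, the corrector is the sum of `G` along paths
that start at `x`. -/
theorem IsGood.corrector_shift_eq (hM : IsLatticeModel τ 𝒢) (h : IsGood τ 𝒢 G A ω) {x y : Zd d}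
    (hx : x ∈ infCluster 𝒢 ω) (p : (𝒢 ω).Walk x (x + y)) :
    corrector τ 𝒢 G (τ x ω) y = pathSum τ 𝒢 G ω p := by
  have h0 : 0 ∈ infCluster 𝒢 (τ x ω) := (hM.shift_mem_originInf x ω).2 hx
  have key {a b : Zd d} (q : (𝒢 (τ x ω)).Walk a b) (ha : a = 0) (hb : b = y) :
      corrector τ 𝒢 G (τ x ω) y = pathSum τ 𝒢 G (τ x ω) q := by
    subst ha hb
    exact (h.loopFree.shift hM x).corrector_eq h0 q
  rw [← hM.pathSum_map_shiftIso x ω p]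
  exact key _ (sub_self x) (add_sub_cancel_left x y)

theorem IsGood.corrector_add (hM : IsLatticeModel τ 𝒢) (h : IsGood τ 𝒢 G A ω) {x y : Zd d}
    (h0 : 0 ∈ infCluster 𝒢 ω) (hx : x ∈ infCluster 𝒢 ω) (hxy : x + y ∈ infCluster 𝒢 ω) :
    corrector τ 𝒢 G ω (x + y) = corrector τ 𝒢 G ω x + corrector τ 𝒢 G (τ x ω) y := by
  obtain ⟨p⟩ := h.reachable 0 h0 x hx
  obtain ⟨q⟩ := h.reachable x hx _ hxy
  rw [h.loopFree.corrector_eq h0 p, h.corrector_shift_eq hM hx q,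
    h.loopFree.corrector_eq h0 (p.append q), pathSum_append]

/-- The corrector is Lipschitz with respect to the chemical distance. -/
theorem IsGood.abs_corrector_sub_le (hM : IsLatticeModel τ 𝒢) (h : IsGood τ 𝒢 G A ω) {x y : Zd d}
    (h0 : 0 ∈ infCluster 𝒢 ω) (hx : x ∈ infCluster 𝒢 ω) (hy : y ∈ infCluster 𝒢 ω) :
    |corrector τ 𝒢 G ω y - corrector τ 𝒢 G ω x| ≤ A * chemDist 𝒢 ω x y := by
  have hxy : x + (y - x) = y := add_sub_cancel x y
  have h1 := h.corrector_add hM h0 hx (y := y - x) (by rwa [hxy])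
  rw [hxy] at h1
  have h2 := (h.shift hM x).abs_corrector_le ((hM.shift_mem_originInf x ω).2 hx) (y - x)
  rw [hM.chemDist_shift, hxy, add_zero] at h2
  rwa [h1, add_sub_cancel_left]

end Shifts

/-! ### Measurability of clusters and of the corrector -/

section Measurability

variable {d : ℕ} {Ω : Type} [MeasurableSpace Ω] {τ : Zd d → Ω → Ω} {𝒢 : Ω → SimpleGraph (Zd d)}
  {G : Ω → Zd d → ℝ} {A : ℝ} {ω : Ω} {P : Measure Ω}

theorem exists_walk_length_succ_iff {V : Type*} (H : SimpleGraph V) (x y : V) (n : ℕ) :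
    (∃ p : H.Walk x y, p.length = n + 1) ↔
      ∃ w, (∃ q : H.Walk x w, q.length = n) ∧ H.Adj w y := by
  constructor
  · rintro ⟨p, hp⟩
    rw [← SimpleGraph.Walk.length_reverse] at hp
    cases hr : p.reverse with
    | nil => simp [hr] at hp
    | @cons _ w _ h q =>
      rw [hr, SimpleGraph.Walk.length_cons] at hp
      exact ⟨w, ⟨q.reverse, by simpa using hp⟩, h.symm⟩
  · rintro ⟨w, ⟨q, hq⟩, h⟩
    exact ⟨q.concat h, by simp [hq]⟩

theorem measurableSet_walk (hM : IsLatticeModel τ 𝒢) (n : ℕ) (x y : Zd d) :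
    MeasurableSet {ω | ∃ p : (𝒢 ω).Walk x y, p.length = n} := by
  induction n generalizing y with
  | zero =>
    simp only [SimpleGraph.Walk.exists_length_eq_zero_iff]
    exact MeasurableSet.const _
  | succ n ih =>
    have : {ω | ∃ p : (𝒢 ω).Walk x y, p.length = n + 1} =
        ⋃ w, {ω | ∃ q : (𝒢 ω).Walk x w, q.length = n} ∩ {ω | (𝒢 ω).Adj w y} := by
      ext ω
      simp only [exists_walk_length_succ_iff, Set.mem_iUnion, Set.mem_inter_iff,
        Set.mem_ofPred_eq]
    rw [this]
    exact MeasurableSet.iUnion fun w => (ih w).inter (hM.measurableSet_adj w y)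

theorem measurableSet_reachable (hM : IsLatticeModel τ 𝒢) (x y : Zd d) :
    MeasurableSet {ω | (𝒢 ω).Reachable x y} := by
  have : {ω | (𝒢 ω).Reachable x y} = ⋃ n, {ω | ∃ p : (𝒢 ω).Walk x y, p.length = n} := by
    ext ω
    simp only [Set.mem_iUnion, Set.mem_ofPred_eq]
    exact ⟨fun ⟨p⟩ => ⟨_, p, rfl⟩, fun ⟨_, p, _⟩ => ⟨p⟩⟩
  rw [this]
  exact MeasurableSet.iUnion fun n => measurableSet_walk hM n x y

theorem measurableSet_mem_infCluster (hM : IsLatticeModel τ 𝒢) (x : Zd d) :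
    MeasurableSet {ω | x ∈ infCluster 𝒢 ω} := by
  have : {ω | x ∈ infCluster 𝒢 ω} =
      ⋂ s : Finset (Zd d), ⋃ y : {y : Zd d // y ∉ s}, {ω | (𝒢 ω).Reachable y x} := by
    ext ω
    simp only [Set.mem_iInter, Set.mem_iUnion, Set.mem_ofPred_eq, mem_infCluster_iff]
    constructor
    · intro h s
      obtain ⟨y, hy, hys⟩ := h.exists_notMem_finset s
      exact ⟨⟨y, hys⟩, hy⟩
    · intro h hfin
      obtain ⟨⟨y, hys⟩, hy⟩ := h hfin.toFinset
      exact hys (by simpa using hy)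
  rw [this]
  exact MeasurableSet.iInter fun s => MeasurableSet.iUnion fun y => measurableSet_reachable hM y x

theorem measurableSet_originInf (hM : IsLatticeModel τ 𝒢) : MeasurableSet (originInf 𝒢) :=
  measurableSet_mem_infCluster hM 0

theorem ae_condOrigin_iff (hM : IsLatticeModel τ 𝒢) [IsFiniteMeasure P] {p : Ω → Prop} :
    (∀ᵐ ω ∂(condOrigin 𝒢 P), p ω) ↔ ∀ᵐ ω ∂P, ω ∈ originInf 𝒢 → p ω := by
  rw [condOrigin, ProbabilityTheory.cond, Measure.ae_ennreal_smul_measure_iff,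
    ae_restrict_iff' (measurableSet_originInf hM)]
  exact ENNReal.inv_ne_zero.2 (measure_ne_top _ _)

variable [Preorder Ω]

namespace StandingAssumptions

theorem measurePreserving (hP : StandingAssumptions τ 𝒢 P) (hM : IsLatticeModel τ 𝒢) (z : Zd d) :
    MeasurePreserving (τ z) P P := by
  by_cases hz : z = 0
  · have : τ z = id := by
      funext ω
      rw [hz, hM.shift_zero, id]
    rw [this]
    exact MeasurePreserving.id P
  · exact (hP.ergodic z hz).toMeasurePreserving

theorem ae_shift (hP : StandingAssumptions τ 𝒢 P) (hM : IsLatticeModel τ 𝒢) {p : Ω → Prop}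
    (h : ∀ᵐ ω ∂P, p ω) : ∀ᵐ ω ∂P, ∀ z, p (τ z ω) :=
  ae_all_iff.2 fun z => (hP.measurePreserving hM z).quasiMeasurePreserving.ae h

theorem exists_ae_isGood (hP : StandingAssumptions τ 𝒢 P) (hM : IsLatticeModel τ 𝒢)
    (hG : GradientClass τ 𝒢 P G) : ∃ A, 0 ≤ A ∧ ∀ᵐ ω ∂P, IsGood τ 𝒢 G A ω := by
  have := hP.prob
  obtain ⟨A, hA⟩ := hG.bounded
  refine ⟨max A 0, le_max_right _ _, ?_⟩
  have hb : ∀ᵐ ω ∂P, ∀ e : steps d, ω ∈ originInf 𝒢 → G ω e ≤ A :=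
    ae_all_iff.2 fun e => (ae_condOrigin_iff hM).1 (hA e e.2)
  filter_upwards [hP.unique_cluster, hP.ae_shift hM hb,
    hP.ae_shift hM ((ae_condOrigin_iff hM).1 hG.closed_loop)] with ω h1 h2 h3
  refine ⟨fun x hx y hy => ?_, fun x hx => ?_, fun x hx y hxy => ?_⟩
  · exact SimpleGraph.ConnectedComponent.eq.1 (h1.unique hx hy)
  · exact LoopFree.of_shift hM (h3 x ((hM.shift_mem_originInf x ω).2 hx)) x hx
  · exact (h2 x ⟨_, hM.sub_mem_steps ω x y hxy⟩ ((hM.shift_mem_originInf x ω).2 hx)).trans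
      (le_max_left _ _)

theorem aemeasurable_gradient_shift (hP : StandingAssumptions τ 𝒢 P) (hM : IsLatticeModel τ 𝒢)
    (hG : GradientClass τ 𝒢 P G) {e : Zd d} (he : e ∈ steps d) (z : Zd d) :
    AEMeasurable (fun ω => G (τ z ω) e) (P.restrict {ω | z ∈ infCluster 𝒢 ω}) := by
  have := hP.prob
  have h1 : AEMeasurable (fun ω => G ω e) (P.restrict (originInf 𝒢)) := by
    have h := hG.meas e he
    rw [condOrigin, ProbabilityTheory.cond] at h
    refine h.mono_ac ?_
    exact Measure.absolutelyContinuous_smul (ENNReal.inv_ne_zero.2 (measure_ne_top _ _))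
  have h2 := (hP.measurePreserving hM z).restrict_preimage (measurableSet_originInf hM)
  have h3 : τ z ⁻¹' originInf 𝒢 = {ω | z ∈ infCluster 𝒢 ω} := by
    ext ω
    exact hM.shift_mem_originInf z ω
  rw [h3] at h2
  exact h1.comp_quasiMeasurePreserving h2.quasiMeasurePreserving

theorem aemeasurable_corrector_restrict_walk (hP : StandingAssumptions τ 𝒢 P)
    (hM : IsLatticeModel τ 𝒢) (hG : GradientClass τ 𝒢 P G) (n : ℕ) (x : Zd d) :
    AEMeasurable (fun ω => corrector τ 𝒢 G ω x)
      (P.restrict (originInf 𝒢 ∩ {ω | ∃ p : (𝒢 ω).Walk 0 x, p.length = n})) := by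
  obtain ⟨A, -, hA⟩ := hP.exists_ae_isGood hM hG
  have hm := measurableSet_originInf hM
  induction n generalizing x with
  | zero =>
    by_cases hx : 0 = x
    · subst hx
      refine (aemeasurable_const (b := (0 : ℝ))).congr ?_
      refine (ae_restrict_iff' (hm.inter (measurableSet_walk hM 0 0 0))).2 ?_
      filter_upwards [hA] with ω hω h
      exact (hω.corrector_zero h.1).symm
    · simp [hx]
  | succ n ih =>
    have hU : originInf 𝒢 ∩ {ω | ∃ p : (𝒢 ω).Walk 0 x, p.length = n + 1} =
        ⋃ w, (originInf 𝒢 ∩ {ω | ∃ q : (𝒢 ω).Walk 0 w, q.length = n}) ∩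
          {ω | (𝒢 ω).Adj w x} := by
      ext ω
      simp only [exists_walk_length_succ_iff, Set.mem_iUnion, Set.mem_inter_iff,
        Set.mem_ofPred_eq]
      tauto
    rw [hU, aemeasurable_iUnion_iff]
    intro w
    by_cases hs : x - w ∈ steps d
    · have hsub : (originInf 𝒢 ∩ {ω | ∃ q : (𝒢 ω).Walk 0 w, q.length = n}) ∩
          {ω | (𝒢 ω).Adj w x} ⊆ {ω | w ∈ infCluster 𝒢 ω} := by
        rintro ω ⟨⟨h0, q, -⟩, -⟩
        exact mem_infCluster_of_reachable q.reachable h0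
      refine (((ih w).mono_measure (Measure.restrict_mono Set.inter_subset_left le_rfl)).add
        ((hP.aemeasurable_gradient_shift hM hG hs w).mono_measure
          (Measure.restrict_mono hsub le_rfl))).congr ?_
      refine (ae_restrict_iff' ((hm.inter (measurableSet_walk hM n 0 w)).inter
        (hM.measurableSet_adj w x))).2 ?_
      filter_upwards [hA] with ω hω h
      obtain ⟨⟨h0, q, -⟩, hwx⟩ := h
      rw [hω.loopFree.corrector_eq h0 (q.append (.cons hwx .nil)), pathSum_append,
        Pi.add_apply, hω.loopFree.corrector_eq h0 q]
      simp [pathSum]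
    · have : {ω | (𝒢 ω).Adj w x} = ∅ :=
        Set.eq_empty_of_forall_notMem fun ω h => hs (hM.sub_mem_steps ω w x h)
      simp [this]

theorem aemeasurable_corrector (hP : StandingAssumptions τ 𝒢 P)
    (hM : IsLatticeModel τ 𝒢) (hG : GradientClass τ 𝒢 P G) (x : Zd d) :
    AEMeasurable (fun ω => corrector τ 𝒢 G ω x) (P.restrict (originInf 𝒢)) := by
  have hU : originInf 𝒢 =
      (⋃ n, originInf 𝒢 ∩ {ω | ∃ p : (𝒢 ω).Walk 0 x, p.length = n}) ∪
        (originInf 𝒢 ∩ {ω | (𝒢 ω).Reachable 0 x}ᶜ) := by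
    ext ω
    simp only [Set.mem_union, Set.mem_iUnion, Set.mem_inter_iff, Set.mem_ofPred_eq,
      Set.mem_compl_iff]
    constructor
    · intro h
      by_cases hr : (𝒢 ω).Reachable 0 x
      · exact Or.inl ⟨_, h, hr.some, rfl⟩
      · exact Or.inr ⟨h, hr⟩
    · rintro (⟨_, h, -⟩ | ⟨h, -⟩) <;> exact h
  rw [hU, aemeasurable_union_iff, aemeasurable_iUnion_iff]
  refine ⟨fun n => hP.aemeasurable_corrector_restrict_walk hM hG n x, ?_⟩
  refine (aemeasurable_const (b := (0 : ℝ))).congr ?_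
  refine (ae_restrict_iff' ((measurableSet_originInf hM).inter
    (measurableSet_reachable hM 0 x).compl)).2 (Eventually.of_forall fun ω h => ?_)
  have hr : ¬ (𝒢 ω).Reachable 0 x := h.2
  simp only [corrector, dif_neg hr]

theorem nullMeasurableSet_abs_corrector_le (hP : StandingAssumptions τ 𝒢 P)
    (hM : IsLatticeModel τ 𝒢) (hG : GradientClass τ 𝒢 P G) (x : Zd d) (c : ℝ) :
    NullMeasurableSet (originInf 𝒢 ∩ {ω | |corrector τ 𝒢 G ω x| ≤ c}) P := by
  have hm := measurableSet_originInf hM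
  have h1 : AEMeasurable ((originInf 𝒢).indicator fun ω => corrector τ 𝒢 G ω x) P :=
    (aemeasurable_indicator_iff hm).2 (hP.aemeasurable_corrector hM hG x)
  have h2 := h1.nullMeasurableSet_preimage (measurableSet_Icc (a := -c) (b := c))
  convert hm.nullMeasurableSet.inter h2 using 1
  ext ω
  simp only [Set.mem_inter_iff, Set.mem_ofPred_eq, Set.mem_preimage, Set.mem_Icc]
  refine and_congr_right fun h => ?_
  rw [Set.indicator_of_mem h, abs_le]

/-! ### The increment of the corrector up to the first arrival -/

theorem measurableSet_firstReturn_eq (hP : StandingAssumptions τ 𝒢 P) (hM : IsLatticeModel τ 𝒢)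
    (e : Zd d) (k : ℕ) : MeasurableSet {ω | firstReturn τ 𝒢 ω e = k} := by
  have hs (j : ℕ) :
      MeasurableSet {ω | 1 ≤ j ∧ τ ((j : ℤ) • e) ω ∈ originInf 𝒢} :=
    (MeasurableSet.const _).inter
      ((hP.measurePreserving hM _).measurable (measurableSet_originInf hM))
  have h0 : {ω | firstReturn τ 𝒢 ω e = 0} =
      ⋂ j : ℕ, {ω | 1 ≤ j ∧ τ ((j : ℤ) • e) ω ∈ originInf 𝒢}ᶜ := by
    ext ω
    simp [firstReturn, Nat.sInf_eq_zero, Set.eq_empty_iff_forall_notMem]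
  rcases Nat.eq_zero_or_pos k with rfl | hk
  · rw [h0]
    exact MeasurableSet.iInter fun j => (hs j).compl
  · have : {ω | firstReturn τ 𝒢 ω e = k} =
        {ω | 1 ≤ k ∧ τ ((k : ℤ) • e) ω ∈ originInf 𝒢} ∩
          ⋂ j : Fin k, {ω | 1 ≤ (j : ℕ) ∧ τ (((j : ℕ) : ℤ) • e) ω ∈ originInf 𝒢}ᶜ := by
      ext ω
      simp only [Set.mem_inter_iff, Set.mem_iInter, Set.mem_compl_iff, firstReturn]
      constructor
      · intro h
        have h' : sInf {k : ℕ | 1 ≤ k ∧ τ ((k : ℤ) • e) ω ∈ originInf 𝒢} = k := h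
        refine ⟨?_, fun j hj => ?_⟩
        · have hne := Nat.nonempty_of_pos_sInf (h'.symm ▸ hk)
          have := Nat.sInf_mem hne
          rwa [h'] at this
        · have : sInf {k : ℕ | 1 ≤ k ∧ τ ((k : ℤ) • e) ω ∈ originInf 𝒢} ≤ j := Nat.sInf_le hj
          have := j.2
          omega
      · rintro ⟨h1, h2⟩
        refine le_antisymm (Nat.sInf_le h1) ?_
        by_contra! hlt
        have hmem := Nat.sInf_mem (s := {k : ℕ | 1 ≤ k ∧ τ ((k : ℤ) • e) ω ∈ originInf 𝒢}) ⟨k, h1⟩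
        exact h2 ⟨_, hlt⟩ hmem
    rw [this]
    exact (hs k).inter (MeasurableSet.iInter fun j => (hs j).compl)

theorem aemeasurable_corrector_arrival (hP : StandingAssumptions τ 𝒢 P)
    (hM : IsLatticeModel τ 𝒢) (hG : GradientClass τ 𝒢 P G) (e : Zd d) :
    AEMeasurable (fun ω => corrector τ 𝒢 G ω (arrival τ 𝒢 ω e)) (P.restrict (originInf 𝒢)) := by
  have hU : originInf 𝒢 = ⋃ k, originInf 𝒢 ∩ {ω | firstReturn τ 𝒢 ω e = k} := by
    ext ω
    simp
  rw [hU, aemeasurable_iUnion_iff]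
  intro k
  refine ((hP.aemeasurable_corrector hM hG ((k : ℤ) • e)).mono_measure
    (Measure.restrict_mono Set.inter_subset_left le_rfl)).congr ?_
  refine (ae_restrict_iff' ((measurableSet_originInf hM).inter
    (hP.measurableSet_firstReturn_eq hM e k))).2 (Eventually.of_forall fun ω h => ?_)
  have : firstReturn τ 𝒢 ω e = k := h.2
  change corrector τ 𝒢 G ω ((k : ℤ) • e) = corrector τ 𝒢 G ω (arrival τ 𝒢 ω e)
  rw [arrival, this]

end StandingAssumptions

end Measurability

section Axis

variable {d : ℕ} {Ω : Type} [MeasurableSpace Ω] {τ : Zd d → Ω → Ω} {𝒢 : Ω → SimpleGraph (Zd d)}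
  {G : Ω → Zd d → ℝ} {A : ℝ} {ω : Ω} {P : Measure Ω}

/-- The increment `V_G(ω, v_e)` on `Ω_0`, extended by `0` to all configurations.  Summed along the
orbit of the full shift `τ e`, it only sees the visits to the infinite cluster, so that the ergodic
theorem for `τ e` applies and the induced shift on `Ω_0` is not needed. -/
noncomputable def arrivalIncrement (τ : Zd d → Ω → Ω) (𝒢 : Ω → SimpleGraph (Zd d))
    (G : Ω → Zd d → ℝ) (e : Zd d) : Ω → ℝ :=
  (originInf 𝒢).indicator fun ω => corrector τ 𝒢 G ω (arrival τ 𝒢 ω e)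

theorem IsGood.birkhoffSum_arrivalIncrement (hM : IsLatticeModel τ 𝒢) {e : Zd d} (t : ℕ) :
    ∀ {ω : Ω}, IsGood τ 𝒢 G A ω → 0 ∈ infCluster 𝒢 ω → t • e ∈ infCluster 𝒢 ω →
      birkhoffSum (τ e) (arrivalIncrement τ 𝒢 G e) t ω = corrector τ 𝒢 G ω (t • e) := by
  induction t using Nat.strong_induction_on with
  | _ t ih =>
  intro ω hω h0 ht
  rcases Nat.eq_zero_or_pos t with rfl | htpos
  · rw [zero_smul, hω.corrector_zero h0, birkhoffSum_zero]
  set k := firstReturn τ 𝒢 ω e with hk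
  have htmem : t ∈ {k : ℕ | 1 ≤ k ∧ τ ((k : ℤ) • e) ω ∈ originInf 𝒢} :=
    ⟨htpos, by rw [natCast_zsmul]; exact (hM.shift_mem_originInf _ ω).2 ht⟩
  have hkt : k ≤ t := Nat.sInf_le htmem
  obtain ⟨hk1, hk2⟩ : 1 ≤ k ∧ τ ((k : ℤ) • e) ω ∈ originInf 𝒢 := Nat.sInf_mem ⟨t, htmem⟩
  have hkC : k • e ∈ infCluster 𝒢 ω := by
    rw [natCast_zsmul] at hk2
    exact (hM.shift_mem_originInf _ ω).1 hk2
  have hadd : t • e = k • e + (t - k) • e := by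
    rw [← add_smul, Nat.add_sub_cancel' hkt]
  have hfirst : birkhoffSum (τ e) (arrivalIncrement τ 𝒢 G e) k ω =
      corrector τ 𝒢 G ω (k • e) := by
    rw [birkhoffSum, Finset.sum_eq_single 0]
    · rw [Function.iterate_zero, id, arrivalIncrement,
        Set.indicator_of_mem (show ω ∈ originInf 𝒢 from h0), arrival, ← hk, natCast_zsmul]
    · intro j hj hj0
      rw [hM.iterate_shift, arrivalIncrement, Set.indicator_of_notMem]
      intro hjmem
      have : k ≤ j := Nat.sInf_le ⟨Nat.pos_of_ne_zero hj0, by rwa [natCast_zsmul]⟩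
      exact absurd (Finset.mem_range.1 hj) (by omega)
    · intro h
      exact absurd (Finset.mem_range.2 hk1) h
  have hrest := ih (t - k) (by omega) (hω.shift hM (k • e))
    ((hM.shift_mem_originInf _ ω).2 hkC)
    ((hM.mem_infCluster_shift _ _ _).2 (by rwa [← hadd]))
  have hsplit : birkhoffSum (τ e) (arrivalIncrement τ 𝒢 G e) t ω =
      birkhoffSum (τ e) (arrivalIncrement τ 𝒢 G e) (k + (t - k)) ω := by
    rw [Nat.add_sub_cancel' hkt]
  rw [hsplit, birkhoffSum_add, hfirst, hM.iterate_shift, hrest, hadd]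
  exact (hω.corrector_add hM h0 hkC (by rwa [← hadd])).symm

variable [Preorder Ω]

namespace StandingAssumptions

/-- The corrector is Lipschitz in the chemical distance, which has exponential tails at the first
arrival. -/
theorem integrable_corrector_arrival (hP : StandingAssumptions τ 𝒢 P)
    (hM : IsLatticeModel τ 𝒢) (hG : GradientClass τ 𝒢 P G) (h0 : P (originInf 𝒢) ≠ 0)
    {e : Zd d} (he : e ∈ steps d) :
    Integrable (fun ω => corrector τ 𝒢 G ω (arrival τ 𝒢 ω e)) (condOrigin 𝒢 P) := by
  have := hP.prob
  obtain ⟨A, hA0, hA⟩ := hP.exists_ae_isGood hM hG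
  obtain ⟨c₅, c₆, hc5, hc6, htail⟩ := hP.arrival_tail
  set Q := condOrigin 𝒢 P with hQ
  have : IsProbabilityMeasure Q := ProbabilityTheory.cond_isProbabilityMeasure h0
  refine ⟨?_, ?_⟩
  · exact ((hP.aemeasurable_corrector_arrival hM hG e).smul_measure _).aestronglyMeasurable
  set S : ℕ → Set Ω := fun n => {ω | n < chemDist 𝒢 ω 0 (arrival τ 𝒢 ω e)}
  have hbound : ∀ᵐ ω ∂Q, ‖corrector τ 𝒢 G ω (arrival τ 𝒢 ω e)‖ₑ ≤
      ∑' n, (toMeasurable Q (S n)).indicator (fun _ => ENNReal.ofReal A) ω := by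
    refine (ae_condOrigin_iff hM).2 ?_
    filter_upwards [hA] with ω hω hω0
    set D := chemDist 𝒢 ω 0 (arrival τ 𝒢 ω e) with hD
    calc ‖corrector τ 𝒢 G ω (arrival τ 𝒢 ω e)‖ₑ
        ≤ ENNReal.ofReal (A * D) := by
          rw [Real.enorm_eq_ofReal_abs]
          exact ENNReal.ofReal_le_ofReal (hω.abs_corrector_le hω0 _)
      _ = ∑ n ∈ Finset.range D, ENNReal.ofReal A := by
          rw [Finset.sum_const, Finset.card_range, nsmul_eq_mul, mul_comm A,
            ENNReal.ofReal_mul (by positivity), ENNReal.ofReal_natCast]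
      _ = ∑ n ∈ Finset.range D,
            (toMeasurable Q (S n)).indicator (fun _ => ENNReal.ofReal A) ω := by
          refine Finset.sum_congr rfl fun n hn => ?_
          have : ω ∈ S n := Finset.mem_range.1 hn
          rw [Set.indicator_of_mem (subset_toMeasurable Q (S n) this)]
      _ ≤ _ := ENNReal.sum_le_tsum _
  refine lt_of_le_of_lt (lintegral_mono_ae hbound) ?_
  rw [lintegral_tsum fun n =>
    (measurable_const.indicator (measurableSet_toMeasurable Q (S n))).aemeasurable]
  have hsum : Summable fun n : ℕ => A * (c₅ * Real.exp (-c₆ * n)) := by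
    refine Summable.mul_left _ (Summable.mul_left _ ?_)
    have : (fun n : ℕ => Real.exp (-c₆ * n)) = fun n : ℕ => Real.exp (-c₆) ^ n := by
      funext n
      rw [← Real.exp_nat_mul, mul_comm]
    rw [this]
    exact summable_geometric_of_lt_one (Real.exp_pos _).le (by simpa using hc6)
  refine lt_of_le_of_lt (ENNReal.tsum_le_tsum fun n => ?_) hsum.tsum_ofReal_ne_top.lt_top
  rw [lintegral_indicator_const (measurableSet_toMeasurable Q (S n)), measure_toMeasurable,
    ENNReal.ofReal_mul hA0]
  gcongr
  rw [← ENNReal.ofReal_toReal (measure_ne_top Q (S n))]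
  exact ENNReal.ofReal_le_ofReal (htail e he n)

theorem integrable_arrivalIncrement (hP : StandingAssumptions τ 𝒢 P)
    (hM : IsLatticeModel τ 𝒢) (hG : GradientClass τ 𝒢 P G) (h0 : P (originInf 𝒢) ≠ 0)
    {e : Zd d} (he : e ∈ steps d) : Integrable (arrivalIncrement τ 𝒢 G e) P := by
  have := hP.prob
  rw [arrivalIncrement, integrable_indicator_iff (measurableSet_originInf hM)]
  have h := hP.integrable_corrector_arrival hM hG h0 he
  rwa [condOrigin, ProbabilityTheory.cond, integrable_smul_measure
    (ENNReal.inv_ne_zero.2 (measure_ne_top _ _)) (ENNReal.inv_ne_top.2 h0)] at h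

theorem integral_arrivalIncrement (hP : StandingAssumptions τ 𝒢 P)
    (hM : IsLatticeModel τ 𝒢) (hG : GradientClass τ 𝒢 P G) (h0 : P (originInf 𝒢) ≠ 0)
    {e : Zd d} (he : e ∈ steps d) : ∫ ω, arrivalIncrement τ 𝒢 G e ω ∂P = 0 := by
  have := hP.prob
  rw [arrivalIncrement, integral_indicator (measurableSet_originInf hM)]
  have h := hG.induced_mean_zero e he
  rw [condOrigin, ProbabilityTheory.cond, integral_smul_measure, smul_eq_zero] at h
  refine h.resolve_left ?_
  exact ENNReal.toReal_ne_zero.2 ⟨ENNReal.inv_ne_zero.2 (measure_ne_top _ _), ENNReal.inv_ne_top.2 h0⟩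

/-! ### Sublinearity along the coordinate axes -/

theorem ae_abs_corrector_axis_le (hP : StandingAssumptions τ 𝒢 P)
    (hM : IsLatticeModel τ 𝒢) (hG : GradientClass τ 𝒢 P G) (h0 : P (originInf 𝒢) ≠ 0)
    {e : Zd d} (he : e ∈ steps d) {ε : ℝ} (hε : 0 < ε) :
    ∀ᵐ ω ∂P, ω ∈ originInf 𝒢 → ∀ᶠ t : ℕ in atTop, t • e ∈ infCluster 𝒢 ω →
      |corrector τ 𝒢 G ω (t • e)| ≤ ε * t := by
  have := hP.prob
  obtain ⟨A, -, hA⟩ := hP.exists_ae_isGood hM hG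
  filter_upwards [hA, eventually_abs_birkhoffSum_sub_le (hP.ergodic e (ne_zero_of_mem_steps he))
    (hP.integrable_arrivalIncrement hM hG h0 he) hε] with ω hω hω1 hω0
  filter_upwards [hω1] with t ht hte
  rwa [hP.integral_arrivalIncrement hM hG h0 he, zero_mul, sub_zero,
    hω.birkhoffSum_arrivalIncrement hM t hω0 hte] at ht

/-- Visits of the orbit of an ergodic shift to a set of positive measure leave only gaps that are
short compared with the elapsed time: a gap `[t, (1 + δ) t]` would contradict the convergence of
the visit frequency to a positive limit. -/
theorem ae_exists_shift_mem (hP : StandingAssumptions τ 𝒢 P)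
    (hM : IsLatticeModel τ 𝒢) {e : Zd d} (he : e ∈ steps d) {B : Set Ω}
    (hB : NullMeasurableSet B P) (hPB : P B ≠ 0) {δ : ℝ} (hδ : 0 < δ) (hδ1 : δ ≤ 1) :
    ∀ᵐ ω ∂P, ∀ᶠ t : ℕ in atTop, ∃ s : ℕ, t ≤ s ∧ (s : ℝ) ≤ t + δ * t ∧ τ (s • e) ω ∈ B := by
  have := hP.prob
  set f : Ω → ℝ := B.indicator fun _ => 1 with hf
  have hfi : Integrable f P := (integrable_const (1 : ℝ)).indicator₀ hB
  set b := ∫ ω, f ω ∂P with hb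
  have hbpos : 0 < b := by
    rw [hb, hf, integral_indicator₀ hB]
    simp only [integral_const, MeasurableSet.univ, measureReal_restrict_apply, Set.univ_inter,
      smul_eq_mul, mul_one]
    exact ENNReal.toReal_pos hPB (measure_ne_top _ _)
  have hη : 0 < b * δ / 4 := by positivity
  filter_upwards [eventually_abs_birkhoffSum_sub_le (hP.ergodic e (ne_zero_of_mem_steps he))
    hfi hη] with ω hω
  obtain ⟨T, hT⟩ := eventually_atTop.1 hω
  filter_upwards [eventually_ge_atTop (max T 1)] with t ht
  have ht1 : (1 : ℝ) ≤ t := by exact_mod_cast (le_max_right _ _).trans ht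
  set m := t + ⌈δ * t⌉₊ with hm
  have hm1 : (m : ℝ) ≥ t + δ * t := by
    rw [hm]; push_cast; linarith [Nat.le_ceil (δ * t)]
  by_contra! hcon
  have hsame : birkhoffSum (τ e) f m ω = birkhoffSum (τ e) f t ω := by
    rw [hm, birkhoffSum_add, add_eq_left, birkhoffSum]
    refine Finset.sum_eq_zero fun j hj => ?_
    rw [hM.iterate_shift, hM.iterate_shift, hM.shift_shift, ← add_smul]
    refine Set.indicator_of_notMem (hcon (t + j) (Nat.le_add_right _ _) ?_) _
    have := Nat.lt_ceil.1 (Finset.mem_range.1 hj)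
    push_cast
    linarith
  have h1 := abs_le.1 (hT t ((le_max_left _ _).trans ht))
  have h2 := abs_le.1 (hT m (((le_max_left _ _).trans ht).trans (Nat.le_add_right _ _)))
  rw [hsame] at h2
  -- With `η = b δ / 4` the visit counts at `t` and at `m ≥ (1 + δ) t` differ by at least
  -- `(b δ - η (2 + δ)) t > 0`.
  have h3 : (b - b * δ / 4) * m ≤ (b + b * δ / 4) * t := by linarith [h1.2, h2.1]
  have h4 : (b - b * δ / 4) * (t + δ * t) ≤ (b - b * δ / 4) * m :=
    mul_le_mul_of_nonneg_left hm1 (by nlinarith)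
  have h5 : b * δ * t * (2 - δ) ≤ 0 := by nlinarith
  have h6 : 0 < b * δ * t * (2 - δ) := by
    have : 0 < 2 - δ := by linarith
    positivity
  linarith

/-- The orbit along an axis contains, close to any prescribed time, a visit to `B` at which the
corrector is small. -/
theorem ae_exists_visit (hP : StandingAssumptions τ 𝒢 P)
    (hM : IsLatticeModel τ 𝒢) (hG : GradientClass τ 𝒢 P G) (h0 : P (originInf 𝒢) ≠ 0)
    {e : Zd d} (he : e ∈ steps d) {B : Set Ω}
    (hB : NullMeasurableSet B P) (hPB : P B ≠ 0) (hB0 : B ⊆ originInf 𝒢) {δ : ℝ} (hδ : 0 < δ)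
    (hδ1 : δ ≤ 1) :
    ∀ᵐ ω ∂P, ω ∈ originInf 𝒢 → ∃ M : ℕ, ∀ t : ℕ, ∃ s : ℕ, |(s : ℝ) - t| ≤ δ * t + M ∧
      τ (s • e) ω ∈ B ∧ |corrector τ 𝒢 G ω (s • e)| ≤ δ * t + M := by
  filter_upwards [hP.ae_exists_shift_mem hM he hB hPB hδ hδ1,
    hP.ae_abs_corrector_axis_le hM hG h0 he (half_pos hδ)] with ω h1 h2 hω0
  obtain ⟨T, hT⟩ := eventually_atTop.1 (h1.and (h2 hω0))
  refine ⟨2 * T, fun t => ?_⟩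
  obtain ⟨s, hs1, hs2, hs3⟩ := (hT (max t T) (le_max_right _ _)).1
  have hsV := (hT s ((le_max_right _ _).trans hs1)).2
    ((hM.shift_mem_originInf _ ω).1 (hB0 hs3))
  have hts : (t : ℝ) ≤ s := by exact_mod_cast (le_max_left t T).trans hs1
  have hmax : ((max t T : ℕ) : ℝ) ≤ t + T := by
    exact_mod_cast max_le_add_of_nonneg (Nat.zero_le _) (Nat.zero_le _)
  have ht0 : (0 : ℝ) ≤ t := Nat.cast_nonneg t
  have hT0 : (0 : ℝ) ≤ T := Nat.cast_nonneg T
  have hmax2 : ((max t T : ℕ) : ℝ) + δ * (max t T : ℕ) ≤ t + δ * t + 2 * T := by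
    nlinarith [mul_le_mul_of_nonneg_left hmax hδ.le]
  refine ⟨s, ?_, hs3, ?_⟩
  · rw [abs_of_nonneg (by linarith)]
    push_cast
    linarith
  · push_cast
    refine hsV.trans ?_
    nlinarith

end StandingAssumptions

end Axis

/-! ### Points of small corrector near every site -/

section Norms

variable {d : ℕ}

theorem norm_nsmul_sub_nsmul_le {e : Zd d} (he : e ∈ steps d) (s t : ℕ) :
    ‖s • e - t • e‖ ≤ |(s : ℝ) - t| := by
  refine (pi_norm_le_iff_of_nonneg (abs_nonneg _)).2 fun j => ?_
  have hj : |(e j : ℝ)| ≤ 1 := by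
    obtain ⟨i, rfl | rfl⟩ := he <;> by_cases hij : j = i <;> simp [unitVec, hij]
  have : (s • e - t • e) j = ((s : ℤ) - t) * e j := by
    simp [sub_mul]
  rw [this, Int.norm_eq_abs]
  push_cast
  rw [abs_mul]
  exact mul_le_of_le_one_right (abs_nonneg _) hj

theorem norm_nsmul_unitVec (i : Fin d) (m : ℕ) : ‖m • (unitVec i : Zd d)‖ = m := by
  have : m • (unitVec i : Zd d) = Pi.single i (m : ℤ) := by
    rw [unitVec, ← Pi.single_smul]
    simp
  rw [this, Pi.norm_single]
  simp

theorem norm_le_norm1 (x : Zd d) : ‖x‖ ≤ norm1 x := by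
  refine (pi_norm_le_iff_of_nonneg (Finset.sum_nonneg fun i _ => abs_nonneg _)).2 fun j => ?_
  rw [Int.norm_eq_abs]
  exact Finset.single_le_sum (f := fun i => |(x i : ℝ)|) (fun i _ => abs_nonneg _)
    (Finset.mem_univ j)

theorem norm1_le (x : Zd d) : norm1 x ≤ d * ‖x‖ := by
  have : norm1 x ≤ ∑ _i : Fin d, ‖x‖ := Finset.sum_le_sum fun i _ => by
    rw [← Int.norm_eq_abs]
    exact norm_le_pi_norm x i
  simpa using this

theorem mem_Icc_of_norm_le {x : Zd d} {n : ℕ} (h : ‖x‖ ≤ n) :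
    x ∈ Finset.Icc (fun _ : Fin d => -(n : ℤ)) (fun _ => (n : ℤ)) := by
  have hi (i : Fin d) : |x i| ≤ (n : ℤ) := by
    have := (norm_le_pi_norm x i).trans h
    rw [Int.norm_eq_abs] at this
    exact_mod_cast this
  rw [Finset.mem_Icc]
  exact ⟨fun i => (abs_le.1 (hi i)).1, fun i => (abs_le.1 (hi i)).2⟩

theorem card_Icc_box (n : ℕ) :
    (Finset.Icc (fun _ : Fin d => -(n : ℤ)) (fun _ => (n : ℤ))).card = (2 * n + 1) ^ d := by
  rw [Pi.card_Icc]
  simp only [Int.card_Icc, Finset.prod_const, Finset.card_univ, Fintype.card_fin]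
  congr 1
  omega

end Norms

section Net

variable {d : ℕ} {Ω : Type} [MeasurableSpace Ω] {τ : Zd d → Ω → Ω}
  {𝒢 : Ω → SimpleGraph (Zd d)} {G : Ω → Zd d → ℝ} {A : ℝ} {P : Measure Ω}

/-- `ω` has, near every site `x` whose coordinates outside `S` vanish, a point of its infinite
cluster at which the corrector is small, where near and small mean up to `δ ‖x‖ + M`. -/
def HasNet (τ : Zd d → Ω → Ω) (𝒢 : Ω → SimpleGraph (Zd d)) (G : Ω → Zd d → ℝ)
    (S : Finset (Fin d)) (δ : ℝ) (M : ℕ) (ω : Ω) : Prop :=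
  ∀ x : Zd d, (∀ i ∉ S, x i = 0) → ∃ y ∈ infCluster 𝒢 ω,
    ‖y - x‖ ≤ δ * ‖x‖ + M ∧ |corrector τ 𝒢 G ω y| ≤ δ * ‖x‖ + M

/-- Moving first along the `i`-th axis, to a visit of a configuration that has a net in the
directions `S`, yields a net in the directions `insert i S`. -/
theorem IsGood.hasNet_insert (hM : IsLatticeModel τ 𝒢) {ω : Ω} (hω : IsGood τ 𝒢 G A ω)
    (h0 : 0 ∈ infCluster 𝒢 ω) {i : Fin d} {S : Finset (Fin d)} {B : Set Ω} {δ : ℝ} (hδ : 0 < δ)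
    {M₁ M₂ : ℕ} (hB0 : B ⊆ originInf 𝒢)
    (hB : ∀ ω ∈ B, IsGood τ 𝒢 G A ω → HasNet τ 𝒢 G S δ M₁ ω)
    (hvisit : ∀ e, e = unitVec i ∨ e = -unitVec i → ∀ t : ℕ, ∃ s : ℕ,
      |(s : ℝ) - t| ≤ δ * t + M₂ ∧ τ (s • e) ω ∈ B ∧
        |corrector τ 𝒢 G ω (s • e)| ≤ δ * t + M₂) :
    HasNet τ 𝒢 G (insert i S) (2 * δ) (M₁ + M₂) ω := by
  intro x hx
  set t := (x i).natAbs with ht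
  obtain ⟨e, he, hte⟩ : ∃ e : Zd d, (e = unitVec i ∨ e = -unitVec i) ∧
      t • e = Pi.single i (x i) := by
    rcases Int.natAbs_eq (x i) with h | h
    · refine ⟨unitVec i, Or.inl rfl, ?_⟩
      rw [unitVec, ← Pi.single_smul, nsmul_eq_mul, mul_one, ht, ← h]
    · refine ⟨-unitVec i, Or.inr rfl, ?_⟩
      rw [unitVec, ← Pi.single_neg, ← Pi.single_smul, nsmul_eq_mul, mul_neg, mul_one, ht, ← h]
  have htx : (t : ℝ) ≤ ‖x‖ := by
    have := norm_le_pi_norm x i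
    rwa [Int.norm_eq_abs, ← Int.cast_abs, Int.abs_eq_natAbs, Int.cast_natCast, ← ht] at this
  obtain ⟨s, hs1, hs2, hs3⟩ := hvisit e he t
  have hsC : s • e ∈ infCluster 𝒢 ω := (hM.shift_mem_originInf _ ω).1 (hB0 hs2)
  set x' := x - t • e with hx'
  have hx'j (j : Fin d) : x' j = if j = i then 0 else x j := by
    rw [hx', hte, Pi.sub_apply, Pi.single_apply]
    split_ifs with h
    · rw [h, sub_self]
    · rw [sub_zero]
  have hx'n : ‖x'‖ ≤ ‖x‖ := by
    refine (pi_norm_le_iff_of_nonneg (norm_nonneg x)).2 fun j => ?_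
    rw [hx'j]
    split_ifs
    · simp
    · exact norm_le_pi_norm x j
  obtain ⟨y, hyC, hy1, hy2⟩ := hB _ hs2 (hω.shift hM _) x' (by
    intro j hj
    rw [hx'j]
    split_ifs with h
    · rfl
    · exact hx j (by simp [h, hj]))
  have hyC' := (hM.mem_infCluster_shift _ _ _).1 hyC
  have hstep : e ∈ steps d := ⟨i, he⟩
  have hδt : δ * t ≤ δ * ‖x‖ := mul_le_mul_of_nonneg_left htx hδ.le
  have hδx : δ * ‖x'‖ ≤ δ * ‖x‖ := mul_le_mul_of_nonneg_left hx'n hδ.le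
  refine ⟨s • e + y, hyC', ?_, ?_⟩
  · have : s • e + y - x = (s • e - t • e) + (y - x') := by rw [hx']; abel
    rw [this]
    push_cast
    linarith [norm_add_le (s • e - t • e) (y - x'), norm_nsmul_sub_nsmul_le hstep s t]
  · rw [hω.corrector_add hM h0 hsC hyC']
    push_cast
    linarith [abs_add_le (corrector τ 𝒢 G ω (s • e)) (corrector τ 𝒢 G (τ (s • e) ω) y)]

variable [Preorder Ω]

namespace StandingAssumptions

/-- With positive probability there is a net with a fixed constant `M`: almost every configuration
of `Ω_0` makes the required visits with some random integer constant, so one value of this constant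
has positive probability. The corrector is only almost everywhere measurable, hence
`NullMeasurableSet`. -/
theorem exists_hasNet (hP : StandingAssumptions τ 𝒢 P) (hM : IsLatticeModel τ 𝒢)
    (hG : GradientClass τ 𝒢 P G) (h0 : P (originInf 𝒢) ≠ 0) (S : Finset (Fin d)) :
    ∀ δ : ℝ, 0 < δ → δ ≤ 1 → ∃ B ⊆ originInf 𝒢, NullMeasurableSet B P ∧ P B ≠ 0 ∧
      ∃ M : ℕ, ∀ ω ∈ B, IsGood τ 𝒢 G A ω → HasNet τ 𝒢 G S δ M ω := by
  have := hP.prob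
  induction S using Finset.induction_on with
  | empty =>
    intro δ hδ _
    refine ⟨originInf 𝒢, le_rfl, (measurableSet_originInf hM).nullMeasurableSet, h0, 0, ?_⟩
    intro ω hω hgood x hx
    have hx0 : x = 0 := funext fun i => hx i (Finset.notMem_empty i)
    refine ⟨0, hω, ?_, ?_⟩
    · simp [hx0]
    · rw [hgood.corrector_zero hω, hx0]
      simp
  | insert i S _ ih =>
    intro δ hδ hδ1
    obtain ⟨B, hB0, hBm, hPB, M₁, hB⟩ := ih (δ / 2) (by linarith) (by linarith)
    set E : Bool → Zd d := fun b => if b then unitVec i else -unitVec i with hE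
    have hEstep (b : Bool) : E b ∈ steps d := by
      cases b
      · exact neg_unitVec_mem_steps i
      · exact unitVec_mem_steps i
    set D : ℕ → Set Ω := fun M => originInf 𝒢 ∩ ⋂ b : Bool, ⋂ t : ℕ, ⋃ s : ℕ,
      {_ω | |(s : ℝ) - t| ≤ δ / 2 * t + M} ∩ (τ (s • E b) ⁻¹' B ∩
        (originInf 𝒢 ∩ {ω | |corrector τ 𝒢 G ω (s • E b)| ≤ δ / 2 * t + M})) with hD
    have hDm (M : ℕ) : NullMeasurableSet (D M) P := by
      refine (measurableSet_originInf hM).nullMeasurableSet.inter ?_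
      refine NullMeasurableSet.iInter fun b => NullMeasurableSet.iInter fun t =>
        NullMeasurableSet.iUnion fun s => ?_
      refine (MeasurableSet.const _).nullMeasurableSet.inter (NullMeasurableSet.inter ?_ ?_)
      · exact hBm.preimage (hP.measurePreserving hM _).quasiMeasurePreserving
      · exact hP.nullMeasurableSet_abs_corrector_le hM hG _ _
    have hcover : (originInf 𝒢 : Set Ω) ≤ᵐ[P] ⋃ M, D M := by
      have hv := ae_all_iff.2 fun b : Bool => hP.ae_exists_visit hM hG h0 (hEstep b) hBm hPB hB0
        (half_pos hδ) (by linarith)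
      filter_upwards [hv] with ω hω hω0
      choose M hMv using fun b => hω b hω0
      refine Set.mem_iUnion.2 ⟨M true + M false, hω0, ?_⟩
      simp only [Set.mem_iInter, Set.mem_iUnion]
      intro b t
      obtain ⟨s, hs1, hs2, hs3⟩ := hMv b t
      have hle : (M b : ℝ) ≤ ((M true + M false : ℕ) : ℝ) := by
        cases b <;> simp
      exact ⟨s, hs1.trans (by linarith), hs2, hω0, hs3.trans (by linarith)⟩
    obtain ⟨M₂, hM₂⟩ : ∃ M, P (D M) ≠ 0 := by
      by_contra! hcon
      exact h0 (le_antisymm ((measure_mono_ae hcover).trans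
        (measure_iUnion_null hcon).le) zero_le)
    refine ⟨D M₂, Set.inter_subset_left, hDm M₂, hM₂, M₁ + M₂, ?_⟩
    intro ω hω hgood
    have hres := hgood.hasNet_insert hM hω.1 (half_pos hδ) hB0 hB (i := i) (M₂ := M₂) ?_
    · rwa [mul_div_cancel₀ δ two_ne_zero] at hres
    intro e he t
    have hω2 := hω.2
    simp only [Set.mem_iInter, Set.mem_iUnion] at hω2
    rcases he with rfl | rfl
    · obtain ⟨s, hs1, hs2, -, hs3⟩ := hω2 true t
      exact ⟨s, hs1, hs2, hs3⟩
    · obtain ⟨s, hs1, hs2, -, hs3⟩ := hω2 false t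
      exact ⟨s, hs1, hs2, hs3⟩

theorem ae_exists_hasNet_univ (hP : StandingAssumptions τ 𝒢 P) (hM : IsLatticeModel τ 𝒢)
    (hG : GradientClass τ 𝒢 P G) (h0 : P (originInf 𝒢) ≠ 0) (i : Fin d) {δ : ℝ} (hδ : 0 < δ)
    (hδ1 : δ ≤ 1) :
    ∀ᵐ ω ∂P, ω ∈ originInf 𝒢 → ∃ M : ℕ, HasNet τ 𝒢 G Finset.univ δ M ω := by
  obtain ⟨A, -, hA⟩ := hP.exists_ae_isGood hM hG
  obtain ⟨B, hB0, hBm, hPB, M₁, hB⟩ := hP.exists_hasNet (A := A) hM hG h0 Finset.univ δ hδ hδ1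
  filter_upwards [hA, hP.ae_exists_visit hM hG h0 (unitVec_mem_steps i) hBm hPB hB0 hδ hδ1]
    with ω hω hv hω0
  obtain ⟨M₂, hM₂⟩ := hv hω0
  -- A visit to `B` at a bounded distance from the origin is a new centre for the net.
  obtain ⟨s, hs1, hs2, hs3⟩ := hM₂ 0
  have hsC := (hM.shift_mem_originInf _ ω).1 (hB0 hs2)
  rw [Nat.cast_zero, mul_zero, zero_add] at hs1 hs3
  rw [sub_zero, Nat.abs_cast] at hs1
  refine ⟨M₁ + 2 * M₂, fun x _ => ?_⟩
  obtain ⟨y, hyC, hy1, hy2⟩ := hB _ hs2 (hω.shift hM _) (x - s • unitVec i)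
    fun j hj => absurd (Finset.mem_univ j) hj
  have hyC' := (hM.mem_infCluster_shift _ _ _).1 hyC
  have hn : ‖x - s • unitVec i‖ ≤ ‖x‖ + M₂ := by
    have := norm_sub_le x (s • unitVec i)
    rw [norm_nsmul_unitVec] at this
    linarith
  have hδn : δ * ‖x - s • unitVec i‖ ≤ δ * ‖x‖ + M₂ := by
    have h1 := mul_le_mul_of_nonneg_left hn hδ.le
    have h2 : δ * (M₂ : ℝ) ≤ M₂ := mul_le_of_le_one_left (Nat.cast_nonneg _) hδ1
    linarith
  have hM0 : (0 : ℝ) ≤ M₂ := Nat.cast_nonneg _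
  refine ⟨s • unitVec i + y, hyC', ?_, ?_⟩
  · have : s • unitVec i + y - x = y - (x - s • unitVec i) := by abel
    rw [this]
    push_cast
    linarith
  · rw [hω.corrector_add hM hω0 hsC hyC']
    push_cast
    linarith [abs_add_le (corrector τ 𝒢 G ω (s • unitVec i))
      (corrector τ 𝒢 G (τ (s • unitVec i) ω) y)]

end StandingAssumptions

end Net

/-! ### Chemical distance in large boxes -/

section Chemical

/-- `exp(-c₃ (log w)^{1 + c₄})` decays faster than every power of `w`. -/
theorem eventually_exp_neg_log_rpow_le {c₃ c₄ : ℝ} (hc₃ : 0 < c₃) (hc₄ : 0 < c₄) (k : ℕ) :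
    ∀ᶠ w : ℝ in atTop, Real.exp (-c₃ * Real.log w ^ (1 + c₄)) ≤ (w ^ k)⁻¹ := by
  have h1 : Tendsto (fun w => c₃ * Real.log w ^ c₄) atTop atTop :=
    ((tendsto_rpow_atTop hc₄).comp Real.tendsto_log_atTop).const_mul_atTop hc₃
  filter_upwards [h1.eventually_ge_atTop (k : ℝ), eventually_gt_atTop 1] with w hw hw1
  have hlog : 0 < Real.log w := Real.log_pos hw1
  have hw0 : 0 < w := by linarith
  rw [Real.rpow_add hlog, Real.rpow_one, ← Real.exp_log (inv_pos.2 (pow_pos hw0 k)),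
    Real.exp_le_exp, Real.log_inv, Real.log_pow]
  nlinarith [mul_le_mul_of_nonneg_right hw hlog.le]

variable {d : ℕ} {Ω : Type} [MeasurableSpace Ω] {τ : Zd d → Ω → Ω} {𝒢 : Ω → SimpleGraph (Zd d)}
  {G : Ω → Zd d → ℝ} {P : Measure Ω} [Preorder Ω]

namespace StandingAssumptions

/-- By a union bound over pairs of sites and the Borel–Cantelli lemma, the chemical distance is
comparable to the lattice distance for all points of the infinite cluster in a box of size `n`
whose distance is at least `δ n`. -/
theorem exists_ae_eventually_chemDist_le (hP : StandingAssumptions τ 𝒢 P)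
    (hM : IsLatticeModel τ 𝒢) : ∃ c : ℝ, 0 ≤ c ∧ ∀ δ : ℝ, 0 < δ → ∀ᵐ ω ∂P, ∀ᶠ n : ℕ in atTop,
      ∀ x ∈ infCluster 𝒢 ω, ∀ y ∈ infCluster 𝒢 ω, ‖x‖ ≤ n → ‖y‖ ≤ 2 * n → δ * n ≤ ‖y - x‖ →
        (chemDist 𝒢 ω x y : ℝ) ≤ c * ‖y - x‖ := by
  have := hP.prob
  obtain ⟨c₁, c₂, c₃, c₄, hc₁, hc₂, hc₃, hc₄, hchem⟩ := hP.chem_bound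
  refine ⟨c₁ * d, by positivity, fun δ hδ => ?_⟩
  set bad : Zd d → Set Ω := fun z => {ω | c₁ * norm1 z ≤ (chemDist 𝒢 ω 0 z : ℝ) ∧
    0 ∈ infCluster 𝒢 ω ∧ z ∈ infCluster 𝒢 ω}
  set box : ℕ → Finset (Zd d) := fun n =>
    Finset.Icc (fun _ => -(n : ℤ)) (fun _ => (n : ℤ))
  set pairs : ℕ → Finset (Zd d × Zd d) := fun n =>
    (box n ×ˢ box (3 * n)).filter fun q => δ * n ≤ ‖q.2‖
  set B : ℕ → Set Ω := fun n => ⋃ q ∈ pairs n, τ q.1 ⁻¹' bad q.2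
  -- There are `O(n ^ (2 d))` pairs, so that a decay of order `2 d + 2` suffices.
  have hcard (n : ℕ) (hn : 1 ≤ n) : ((pairs n).card : ℝ) ≤ (7 * n : ℝ) ^ (2 * d) := by
    have h1 : (pairs n).card ≤ (2 * n + 1) ^ d * (2 * (3 * n) + 1) ^ d := by
      refine (Finset.card_filter_le _ _).trans ?_
      rw [Finset.card_product, card_Icc_box, card_Icc_box]
    have h2 : (2 * n + 1) ^ d * (2 * (3 * n) + 1) ^ d ≤ (7 * n) ^ d * (7 * n) ^ d :=
      Nat.mul_le_mul (Nat.pow_le_pow_left (by omega) d) (Nat.pow_le_pow_left (by omega) d)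
    have h3 : (7 * n) ^ d * (7 * n) ^ d = (7 * n) ^ (2 * d) := by rw [← pow_add, two_mul]
    exact_mod_cast (h1.trans h2).trans h3.le
  obtain ⟨w₀, hw₀⟩ := eventually_atTop.1
    (eventually_exp_neg_log_rpow_le hc₃ hc₄ (2 * d + 2))
  have hlarge : ∀ᶠ n : ℕ in atTop, w₀ ≤ δ * n :=
    (tendsto_natCast_atTop_atTop.const_mul_atTop hδ).eventually_ge_atTop w₀
  have hprob : ∀ᶠ n : ℕ in atTop, ‖P.real (B n)‖ ≤
      (7 ^ (2 * d) * c₂ * (δ ^ (2 * d + 2))⁻¹) * ((n : ℝ) ^ 2)⁻¹ := by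
    filter_upwards [hlarge, eventually_ge_atTop 1] with n hnw hn
    have hn0 : (0 : ℝ) < n := by exact_mod_cast hn
    have hδn : 0 < δ * n := by positivity
    have hone : ∀ q ∈ pairs n,
        P.real (τ q.1 ⁻¹' bad q.2) ≤ c₂ * ((δ * n) ^ (2 * d + 2))⁻¹ := by
      intro q hq
      have hq2 : δ * n ≤ norm1 q.2 := (Finset.mem_filter.1 hq).2.trans (norm_le_norm1 _)
      have hq0 : q.2 ≠ 0 := by
        intro h0
        have := (Finset.mem_filter.1 hq).2
        rw [h0, norm_zero] at this
        linarith
      calc P.real (τ q.1 ⁻¹' bad q.2) ≤ P.real (bad q.2) :=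
            ENNReal.toReal_mono (measure_ne_top _ _)
              ((hP.measurePreserving hM q.1).measure_preimage_le _)
        _ ≤ c₂ * Real.exp (-c₃ * Real.log (norm1 q.2) ^ (1 + c₄)) := hchem _ hq0
        _ ≤ c₂ * (norm1 q.2 ^ (2 * d + 2))⁻¹ :=
            mul_le_mul_of_nonneg_left (hw₀ _ (hnw.trans hq2)) hc₂.le
        _ ≤ c₂ * ((δ * n) ^ (2 * d + 2))⁻¹ := by gcongr
    rw [Real.norm_of_nonneg measureReal_nonneg]
    calc P.real (B n) ≤ ∑ q ∈ pairs n, P.real (τ q.1 ⁻¹' bad q.2) :=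
          measureReal_biUnion_finset_le _ _
      _ ≤ (pairs n).card * (c₂ * ((δ * n) ^ (2 * d + 2))⁻¹) := by
          rw [← nsmul_eq_mul]
          exact Finset.sum_le_card_nsmul _ _ _ hone
      _ ≤ (7 * n : ℝ) ^ (2 * d) * (c₂ * ((δ * n) ^ (2 * d + 2))⁻¹) := by
          gcongr
          exact hcard n hn
      _ = _ := by
          rw [mul_pow, mul_pow, pow_add (n : ℝ)]
          field_simp
  have hsum : Summable fun n => P.real (B n) :=
    Summable.of_norm_bounded_eventually_nat
      ((Real.summable_nat_pow_inv.2 one_lt_two).mul_left _) hprob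
  have hBC : ∑' n, P (B n) ≠ ⊤ := by
    have := hsum.tsum_ofReal_ne_top
    simpa only [measureReal_def, ENNReal.ofReal_toReal (measure_ne_top P _)] using this
  filter_upwards [ae_eventually_notMem hBC] with ω hω
  filter_upwards [hω] with n hn x hx y hy hxn hyn hxy
  by_contra! hlt
  refine hn (Set.mem_iUnion₂.2 ⟨(x, y - x), ?_, ?_⟩)
  · refine Finset.mem_filter.2 ⟨Finset.mem_product.2 ⟨mem_Icc_of_norm_le hxn,
      mem_Icc_of_norm_le ?_⟩, hxy⟩
    push_cast
    linarith [norm_sub_le y x]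
  · refine ⟨?_, (hM.shift_mem_originInf x ω).2 hx, ?_⟩
    · simp only [hM.chemDist_shift, add_zero, add_sub_cancel]
      refine le_trans ?_ hlt.le
      rw [mul_assoc]
      exact mul_le_mul_of_nonneg_left (norm1_le _) hc₁.le
    · rw [hM.mem_infCluster_shift, add_sub_cancel]
      exact hy

/-! ### Sublinearity everywhere -/

/-- Every point `x` of the infinite cluster in a large box is compared with a net point near
`x + ⌈4 δ n⌉ e_i`: this point is at distance of order `δ n` from `x`, so that the bound on the
chemical distance applies. -/
theorem exists_ae_eventually_abs_corrector_le (hP : StandingAssumptions τ 𝒢 P)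
    (hM : IsLatticeModel τ 𝒢) (hG : GradientClass τ 𝒢 P G) (h0 : P (originInf 𝒢) ≠ 0)
    (i : Fin d) : ∃ K : ℝ, 0 ≤ K ∧ ∀ δ : ℝ, 0 < δ → δ ≤ 1 / 10 → ∀ᵐ ω ∂P, ω ∈ originInf 𝒢 →
      ∀ᶠ n : ℕ in atTop, ∀ x ∈ infCluster 𝒢 ω, ‖x‖ ≤ n →
        |corrector τ 𝒢 G ω x| ≤ K * δ * n := by
  obtain ⟨A, hA0, hA⟩ := hP.exists_ae_isGood hM hG
  obtain ⟨c, hc0, hc⟩ := hP.exists_ae_eventually_chemDist_le hM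
  refine ⟨3 + 8 * A * c, by positivity, fun δ hδ hδ1 => ?_⟩
  filter_upwards [hA, hc δ hδ, hP.ae_exists_hasNet_univ hM hG h0 i hδ (by linarith)]
    with ω hω hchem hnet hω0
  obtain ⟨M, hnet⟩ := hnet hω0
  have hlarge : ∀ᶠ n : ℕ in atTop, (M : ℝ) + 1 ≤ δ * n :=
    (tendsto_natCast_atTop_atTop.const_mul_atTop hδ).eventually_ge_atTop _
  filter_upwards [hchem, hlarge] with n hn hMn x hx hxn
  have hM0 : (0 : ℝ) ≤ M := Nat.cast_nonneg M
  have hn0 : (0 : ℝ) ≤ n := Nat.cast_nonneg n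
  have hδn : δ * n ≤ 1 / 10 * n := mul_le_mul_of_nonneg_right hδ1 hn0
  set m := ⌈4 * (δ * n)⌉₊ with hm
  have hm1 : 4 * (δ * n) ≤ m := Nat.le_ceil _
  have hm2 : (m : ℝ) ≤ 5 * (δ * n) := by
    have := (Nat.ceil_lt_add_one (a := 4 * (δ * n)) (by linarith)).le
    linarith
  set x' := x + m • unitVec i with hx'
  have hx'n : ‖x'‖ ≤ 3 / 2 * n := by
    have := norm_add_le x (m • unitVec i)
    rw [norm_nsmul_unitVec] at this
    linarith
  obtain ⟨y, hyC, hy1, hy2⟩ := hnet x' fun j hj => absurd (Finset.mem_univ j) hj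
  have hδx' : δ * ‖x'‖ ≤ 3 / 2 * (δ * n) := by
    have := mul_le_mul_of_nonneg_left hx'n hδ.le
    linarith
  have hyx : y - x = (y - x') + m • unitVec i := by rw [hx']; abel
  have hyx1 : ‖y - x‖ ≤ 8 * (δ * n) := by
    have := norm_add_le (y - x') (m • unitVec i)
    rw [← hyx, norm_nsmul_unitVec] at this
    linarith
  have hyx2 : δ * n ≤ ‖y - x‖ := by
    have h1 := norm_sub_le (y - x) (y - x')
    have h2 : (y - x) - (y - x') = m • unitVec i := by rw [hyx]; abel
    rw [h2, norm_nsmul_unitVec] at h1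
    linarith
  have hyn : ‖y‖ ≤ 2 * n := by
    have h1 := norm_add_le (y - x) x
    rw [sub_add_cancel] at h1
    linarith
  have hLip := hω.abs_corrector_sub_le hM hω0 hx hyC
  have hd := mul_le_mul_of_nonneg_left (hn x hx y hyC hxn hyn hyx2) hA0
  have hd2 : A * (c * ‖y - x‖) ≤ A * (c * (8 * (δ * n))) := by gcongr
  have htri := abs_sub_abs_le_abs_sub (corrector τ 𝒢 G ω x) (corrector τ 𝒢 G ω y)
  rw [abs_sub_comm] at htri
  have : (3 + 8 * A * c) * δ * n = 3 * (δ * n) + A * (c * (8 * (δ * n))) := by ring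
  rw [this]
  linarith

theorem ae_tendsto_maxCorrector (hP : StandingAssumptions τ 𝒢 P)
    (hM : IsLatticeModel τ 𝒢) (hG : GradientClass τ 𝒢 P G) (i : Fin d) :
    ∀ᵐ ω ∂(condOrigin 𝒢 P),
      Tendsto (fun n : ℕ => maxCorrector τ 𝒢 G ω n / (n : ℝ)) atTop (𝓝 0) := by
  have := hP.prob
  by_cases h0 : P (originInf 𝒢) = 0
  · have : condOrigin 𝒢 P = 0 := ProbabilityTheory.cond_eq_zero_of_meas_eq_zero h0
    simp [this]
  obtain ⟨K, hK0, hK⟩ := hP.exists_ae_eventually_abs_corrector_le hM hG h0 i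
  have hall := ae_all_iff.2 fun q : ℕ => hK (1 / (10 * (q + 1))) (by positivity) (by
    gcongr
    linarith [Nat.cast_nonneg (α := ℝ) q])
  refine (ae_condOrigin_iff hM).2 ?_
  filter_upwards [hall] with ω hω hω0
  rw [Metric.tendsto_atTop']
  intro ε hε
  obtain ⟨q, hq⟩ := exists_nat_gt (K / ε)
  have hKq : K * (1 / (10 * (q + 1))) < ε := by
    rw [mul_one_div, div_lt_iff₀ (by positivity)]
    rw [div_lt_iff₀ hε] at hq
    nlinarith [mul_nonneg (Nat.cast_nonneg (α := ℝ) q) hε.le]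
  obtain ⟨N, hN⟩ := eventually_atTop.1 (hω q hω0)
  refine ⟨N, fun n hn => ?_⟩
  have hn0 : (0 : ℝ) < n := by exact_mod_cast (Nat.zero_le N).trans_lt hn
  have hmax0 : 0 ≤ maxCorrector τ 𝒢 G ω n :=
    Real.sSup_nonneg (by rintro _ ⟨x, -, rfl⟩; exact abs_nonneg _)
  have hmax : maxCorrector τ 𝒢 G ω n ≤ K * (1 / (10 * (q + 1))) * n := by
    refine Real.sSup_le ?_ (by positivity)
    rintro _ ⟨x, ⟨hx, hxn⟩, rfl⟩
    exact hN n hn.le x hx hxn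
  rw [Real.dist_eq, sub_zero, abs_of_nonneg (by positivity), div_lt_iff₀ hn0]
  exact hmax.trans_lt (mul_lt_mul_of_pos_right hKq hn0)

end StandingAssumptions

end Chemical

end Percolation

/-- Sub-linear growth of the correctors on the infinite cluster, for bond percolation models and
for site percolation models. -/
theorem theorem4p1 (d : ℕ) (hd : 2 ≤ d) :
    (∀ P : Measure (Percolation.BondConfig d),
      Percolation.StandingAssumptions Percolation.bondShift Percolation.bondGraph P →
      ∀ G : Percolation.BondConfig d → Percolation.Zd d → ℝ,
        Percolation.GradientClass Percolation.bondShift Percolation.bondGraph P G →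
        ∀ᵐ ω ∂(Percolation.condOrigin Percolation.bondGraph P),
          Tendsto (fun n : ℕ =>
            Percolation.maxCorrector Percolation.bondShift Percolation.bondGraph G ω n / (n : ℝ))
            atTop (𝓝 0)) ∧
    (∀ P : Measure (Percolation.SiteConfig d),
      Percolation.StandingAssumptions Percolation.siteShift Percolation.siteGraph P →
      ∀ G : Percolation.SiteConfig d → Percolation.Zd d → ℝ,
        Percolation.GradientClass Percolation.siteShift Percolation.siteGraph P G →
        ∀ᵐ ω ∂(Percolation.condOrigin Percolation.siteGraph P),
          Tendsto (fun n : ℕ =>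
            Percolation.maxCorrector Percolation.siteShift Percolation.siteGraph G ω n / (n : ℝ))
            atTop (𝓝 0)) := by
  have h0 : 0 < d := by omega
  exact ⟨fun P hP G hG => hP.ae_tendsto_maxCorrector (Percolation.isLatticeModel_bond d) hG ⟨0, h0⟩,
    fun P hP G hG => hP.ae_tendsto_maxCorrector (Percolation.isLatticeModel_site d) hG ⟨0, h0⟩⟩
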